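/- **Setting.** Banach spaces are over $\mathbb K=\mathbb R$ or $\mathbb C$. For a Banach space $E$, a set $K\subseteq E^*$ and $\varepsilon>0$, let $s_\varepsilon(K)$ be the set of those $x\in K$ such that $\operatorname{diam}(K\cap V)>\varepsilon$ for every $w^*$-open $V\ni x$. Put $s^0_\varepsilon(K)=K$, $s^{\alpha+1}_\varepsilon(K)=s_\varepsilon(s^\alpha_\varepsilon(K))$, and $s^\alpha_\varepsilon(K)=\bigcap_{\beta<\alpha}s^\beta_\varepsilon(K)$ for limit ordinals $\alpha$. Let $B_{F^*}$ denote the closed unit ball of $F^*$. For a bounded linear operator $T:E\to F$ between Banach spaces, $\mathrm{Sz}_\varepsilon(T)$ is the least ordinal $\alpha$ with $s^\alpha_\varepsilon(T^*B_{F^*})=\emptyset$ (and $\infty$ if there is none), and $\mathrm{Sz}(T)=\sup_{\varepsilon>0}\mathrm{Sz}_\varepsilon(T)$. The operator $T$ is *Asplund* if for every finite measure space $(\Omega,\Sigma,\mu)$, every bounded operator $S:F\to L_\infty(\mu)$ and every $\varepsilon>0$ there is $B\in\Sigma$ with $\mu(B)>\mu(\Omega)-\varepsilon$ such that $\{f\chi_B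 : f\in ST(B_E)\}$ is relatively compact in $L_\infty(\mu)$, where $B_E$ is the closed unit ball of $E$. Fix $r=0$ or $1<r<\infty$, and let $(\bigoplus\cdot)_r$ denote the $c_0$-direct sum if $r=0$ and the $\ell_r$-direct sum otherwise, of spaces and, coordinatewise, of uniformly bounded families of operators. For an operator $S$ let $S_{[n]}=(\bigoplus_{i=1}^nS)_1$ be the $\ell_1$-direct sum of $n$ copies of $S$ and let $S_+=(\bigoplus_{n\ge1}S_{[n]})_r$. For an operator $T$ put $T_0=T$, $T_{\alpha+1}=(T_\alpha)_+$ for every ordinal $\alpha$, and $T_\alpha=(\bigoplus_{\xi<\alpha}T_\xi)_r$ for limit ordinals $\alpha$. **Proposition 4.5.** Let $T$ be a noncompact Asplund operator between Banach spaces. Then $\mathrm{Sz}(T)=\omega^{\alpha_T}$ for a unique ordinal $\alpha_T$, and $\alpha_T=\eta_T+\omega^{\zeta_T}$, where $\zeta_T$ is the last exponent in the Cantor normal form of $\alpha_T$ and $\eta_T$ is the least ordinal $\eta$ with $\alpha_T=\eta+\omega^{\zeta_T}$. Moreover: (i) If $\varepsilon>0$ satisfies $\mathrm{Sz}_\varepsilon(T)>\omega^{\eta_T}$,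 then $\mathrm{Sz}_\varepsilon(T_\alpha)>\omega^{\eta_T+\alpha}$ for every ordinal $\alpha$. (ii) $\mathrm{Sz}(T_\alpha)=\mathrm{Sz}(T)$ for every ordinal $\alpha<\omega^{\zeta_T}$. -/

import Mathlib

open scoped ENNReal NNReal Ordinal Topology
open MeasureTheory

universe u v

noncomputable section

namespace SzlenkOp

/-! ### The Szlenk index -/

section Szlenk

variable {𝕜 : Type*} [RCLike 𝕜]
  {E : Type u} [NormedAddCommGroup E] [NormedSpace 𝕜 E]
  {F : Type u} [NormedAddCommGroup F] [NormedSpace 𝕜 F]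

/-- The derivation `s_ε(K)`: the points `x` of `K ⊆ E*` such that `diam (K ∩ V) > ε` for every
weak-star open `V` containing `x`. The diameter is taken for the dual norm. -/
def szDeriv (ε : ℝ) (K : Set (StrongDual 𝕜 E)) : Set (StrongDual 𝕜 E) :=
  {x | x ∈ K ∧ ∀ V : Set (WeakDual 𝕜 E), IsOpen V → StrongDual.toWeakDual x ∈ V →
    ENNReal.ofReal ε < Metric.ediam (K ∩ {y | StrongDual.toWeakDual y ∈ V})}

/-- The transfinite iterates `s_ε^α(K)`. -/
def iterDeriv (ε : ℝ) (K : Set (StrongDual 𝕜 E)) (α : Ordinal.{u}) : Set (StrongDual 𝕜 E) :=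
  Ordinal.limitRecOn α K (fun _ A => szDeriv ε A) (fun o _ A => ⋂ (β : Ordinal.{u}) (h : β < o), A β h)

/-- The `ε`-Szlenk index of a set `K`: the class of all ordinals `α` with `s_ε^α(K) ≠ ∅`. This
class is an initial segment, so it is the least `α` with `s_ε^α(K) = ∅`, or `⊤` (written `∞` in
the literature) when no iterate is empty. -/
def epsIndexSet (ε : ℝ) (K : Set (StrongDual 𝕜 E)) : WithTop Ordinal.{u} :=
  ⨅ (α : Ordinal.{u}) (_ : iterDeriv ε K α = ∅), (α : WithTop Ordinal.{u})

/-- The set `T*(B_{F*})`. -/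
def dualBallImage (T : E →L[𝕜] F) : Set (StrongDual 𝕜 E) :=
  (fun φ : StrongDual 𝕜 F => φ.comp T) '' Metric.closedBall 0 1

/-- The `ε`-Szlenk index `Sz_ε(T)` of an operator. -/
def epsIndex (ε : ℝ) (T : E →L[𝕜] F) : WithTop Ordinal.{u} :=
  epsIndexSet ε (dualBallImage T)

/-- The Szlenk index `Sz(T)` of an operator, the union of the `Sz_ε(T)` over `ε > 0`. -/
def index (T : E →L[𝕜] F) : WithTop Ordinal.{u} :=
  ⨆ (ε : ℝ) (_ : 0 < ε), epsIndex ε T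

/-- The ordinal `α_T`, determined by `Sz(T) = ω ^ α_T`. -/
def alphaOf (T : E →L[𝕜] F) : Ordinal.{u} :=
  sInf {α | index T = ((ω ^ α : Ordinal.{u}) : WithTop Ordinal.{u})}

/-- The ordinal `ζ_T`, the last exponent in the Cantor normal form of `α_T`; it is determined by
`α_T = η + ω ^ ζ_T` for some `η`. -/
def zetaOf (T : E →L[𝕜] F) : Ordinal.{u} :=
  sInf {ζ | ∃ η : Ordinal.{u}, alphaOf T = η + ω ^ ζ}

/-- The ordinal `η_T`, the least `η` with `α_T = η + ω ^ ζ_T`. -/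
def etaOf (T : E →L[𝕜] F) : Ordinal.{u} :=
  sInf {η | alphaOf T = η + ω ^ zetaOf T}

/-- Asplund operators: for every finite measure space `(Ω, μ)`, every bounded operator
`S : F → L_∞(μ)` and every `ε > 0` there is a measurable `B` with `μ(B) > μ(Ω) - ε` such that
`{f χ_B | f ∈ S T (B_E)}` is relatively compact in `L_∞(μ)`. -/
def IsAsplund (T : E →L[𝕜] F) : Prop :=
  ∀ (Ω : Type u) [MeasurableSpace Ω] (μ : Measure Ω) [IsFiniteMeasure μ]
    (S : F →L[𝕜] Lp 𝕜 ∞ μ) (ε : ℝ), 0 < ε →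
    ∃ B : Set Ω, MeasurableSet B ∧ μ.real Set.univ - ε < μ.real B ∧
      IsCompact (closure {g : Lp 𝕜 ∞ μ | ∃ x : E, ‖x‖ ≤ 1 ∧ g =ᵐ[μ] B.indicator (S (T x))})

end Szlenk

/-! ### Direct sums -/

/-- The admissible exponents `{0} ∪ [1, ∞)` for direct sums; `0` stands for `c_0`-sums. -/
def SumExponent : Type := {p : ℝ // p = 0 ∨ 1 ≤ p}

/-- The exponent of the norm: the sup norm for `c_0`-sums, and the `ℓ_p` norm otherwise. -/
def SumExponent.norm (p : SumExponent) : ℝ≥0∞ :=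
  if p.1 = 0 then ∞ else ENNReal.ofReal p.1

instance (p : SumExponent) : Fact (1 ≤ p.norm) := ⟨by
  unfold SumExponent.norm
  split_ifs with h
  · exact le_top
  · exact ENNReal.one_le_ofReal.2 (p.2.resolve_left h)⟩

section Sum

variable (𝕜 : Type*) [RCLike 𝕜] {ι : Type v}

/-- The direct sum `(⨁ E i)_p` for `p ∈ {0} ∪ [1, ∞)`: the families in `ℓ_p` (in `ℓ_∞` with the
sup norm if `p = 0`) whose norms tend to zero along the index set. The last condition is
automatic for `p ≠ 0`, see `mem_directSum`, and cuts out the `c_0`-sum for `p = 0`. -/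
def directSum (E : ι → Type u) [∀ i, NormedAddCommGroup (E i)] [∀ i, NormedSpace 𝕜 (E i)]
    (p : SumExponent) : Submodule 𝕜 (lp E p.norm) where
  carrier := {f | Filter.Tendsto (fun i => ‖f i‖) Filter.cofinite (𝓝 0)}
  zero_mem' := by
    change Filter.Tendsto (fun i => ‖(0 : lp E p.norm) i‖) Filter.cofinite (𝓝 0)
    simp [tendsto_const_nhds]
  add_mem' := by
    intro f g hf hg
    refine squeeze_zero (fun i => norm_nonneg _) (fun i => norm_add_le (f i) (g i)) ?_
    simpa using hf.add hg
  smul_mem' := by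
    intro c f hf
    have h : Filter.Tendsto (fun i => ‖c‖ * ‖f i‖) Filter.cofinite (𝓝 0) := by
      simpa using Filter.Tendsto.const_mul ‖c‖ hf
    refine squeeze_zero (fun i => norm_nonneg _) (fun i => ?_) h
    exact (norm_smul_le c (f i))

variable {𝕜}
variable {E : ι → Type u} [∀ i, NormedAddCommGroup (E i)] [∀ i, NormedSpace 𝕜 (E i)]

theorem mem_directSum {p : SumExponent} (hp : p.1 ≠ 0) (f : lp E p.norm) :
    f ∈ directSum 𝕜 E p := by
  have h1 : 1 ≤ p.1 := p.2.resolve_left hp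
  have hn : p.norm = ENNReal.ofReal p.1 := by simp [SumExponent.norm, hp]
  have hr : p.norm.toReal = p.1 := by rw [hn, ENNReal.toReal_ofReal (by linarith)]
  have hs := (lp.memℓp f).summable (by rw [hr]; linarith)
  rw [hr] at hs
  have ht := hs.tendsto_cofinite_zero
  have h2 := ht.rpow_const (p := p.1⁻¹) (Or.inr (by positivity))
  rw [Real.zero_rpow (inv_ne_zero hp)] at h2
  refine h2.congr fun i => ?_
  rw [← Real.rpow_mul (norm_nonneg _), mul_inv_cancel₀ hp, Real.rpow_one]

theorem isClosed_directSum (p : SumExponent) :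
    IsClosed (directSum 𝕜 E p : Set (lp E p.norm)) := by
  have hp0 : p.norm ≠ 0 := (zero_lt_one.trans_le (Fact.out : 1 ≤ p.norm)).ne'
  rw [← isSeqClosed_iff_isClosed]
  intro s f hs hf
  have hf' := (Metric.tendsto_atTop.1 hf)
  change Filter.Tendsto (fun i => ‖f i‖) Filter.cofinite (𝓝 0)
  rw [Metric.tendsto_nhds]
  intro ε hε
  obtain ⟨n, hn⟩ := hf' (ε / 2) (half_pos hε)
  have h1 := hn n le_rfl
  have h2 := (Metric.tendsto_nhds.1 (show Filter.Tendsto (fun i => ‖s n i‖) Filter.cofinite (𝓝 0)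
    from hs n)) (ε / 2) (half_pos hε)
  filter_upwards [h2] with i hi
  have h3 : ‖s n i - f i‖ ≤ dist (s n) f := by
    rw [dist_eq_norm]
    exact lp.norm_apply_le_norm hp0 (s n - f) i
  have h4 : ‖f i‖ ≤ ‖s n i‖ + ‖s n i - f i‖ := by
    have := norm_sub_le (s n i) (s n i - f i)
    simpa using this
  simp only [dist_zero_right, norm_norm] at hi ⊢
  linarith

instance [∀ i, CompleteSpace (E i)] (p : SumExponent) : CompleteSpace (directSum 𝕜 E p) :=
  (isClosed_directSum p).completeSpace_coe

variable {F : ι → Type u} [∀ i, NormedAddCommGroup (F i)] [∀ i, NormedSpace 𝕜 (F i)]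

/-- The direct sum `(⨁ T i)_p : (⨁ E i)_p → (⨁ F i)_p`, `(x i) ↦ (T i (x i))`, of a uniformly
bounded family of operators. -/
def directSumMap (p : SumExponent) (C : ℝ≥0) (T : ∀ i, E i →L[𝕜] F i) (hT : ∀ i, ‖T i‖ ≤ C) :
    directSum 𝕜 E p →L[𝕜] directSum 𝕜 F p :=
  ((lp.mapCLM p.norm T C.2 hT).comp (directSum 𝕜 E p).subtypeL).codRestrict (directSum 𝕜 F p) (by
    intro x
    have hx : Filter.Tendsto (fun i => (C : ℝ) * ‖(x : lp E p.norm) i‖) Filter.cofinite (𝓝 0) := by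
      simpa using Filter.Tendsto.const_mul (C : ℝ) x.2
    exact squeeze_zero (fun i => norm_nonneg _) (fun i => (T i).le_of_opNorm_le (hT i) _) hx)

theorem norm_directSumMap_le (p : SumExponent) (C : ℝ≥0) (T : ∀ i, E i →L[𝕜] F i)
    (hT : ∀ i, ‖T i‖ ≤ C) : ‖directSumMap p C T hT‖ ≤ C := by
  refine ContinuousLinearMap.opNorm_le_bound _ C.2 fun x => ?_
  exact (lp.mapCLM p.norm T C.2 hT).le_of_opNorm_le (lp.norm_mapCLM_le p.norm T C.2 hT) x

end Sum

/-! ### The transfinite construction -/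

/-- An operator between Banach spaces with norm at most `C`, bundled with its domain and
codomain. -/
structure BanachOp (𝕜 : Type*) [RCLike 𝕜] (C : ℝ≥0) where
  Dom : Type u
  Cod : Type u
  [domNormed : NormedAddCommGroup Dom]
  [domSpace : NormedSpace 𝕜 Dom]
  [domComplete : CompleteSpace Dom]
  [codNormed : NormedAddCommGroup Cod]
  [codSpace : NormedSpace 𝕜 Cod]
  [codComplete : CompleteSpace Cod]
  op : Dom →L[𝕜] Cod
  norm_op_le : ‖op‖ ≤ C

attribute [instance] BanachOp.domNormed BanachOp.domSpace BanachOp.domComplete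
  BanachOp.codNormed BanachOp.codSpace BanachOp.codComplete

namespace BanachOp

variable {𝕜 : Type*} [RCLike 𝕜] {C : ℝ≥0}

/-- The direct sum `(⨁ S i)_p`. -/
def sum {ι : Type v} (p : SumExponent) (S : ι → BanachOp.{u} 𝕜 C) :
    BanachOp.{max u v} 𝕜 C where
  Dom := directSum 𝕜 (fun i => (S i).Dom) p
  Cod := directSum 𝕜 (fun i => (S i).Cod) p
  op := directSumMap p C (fun i => (S i).op) (fun i => (S i).norm_op_le)
  norm_op_le := norm_directSumMap_le p C _ _

/-- The exponent `1`. -/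
def one : SumExponent := ⟨1, Or.inr le_rfl⟩

/-- `S_[n]`, the `ℓ_1`-direct sum of `n` copies of `S`. -/
def copies (S : BanachOp.{u} 𝕜 C) (n : ℕ) : BanachOp.{u} 𝕜 C :=
  sum one (fun _ : Fin n => S)

/-- `S_+`, the direct sum with exponent `r` of `S_[1], S_[2], S_[3], …`. -/
def plus (r : SumExponent) (S : BanachOp.{u} 𝕜 C) : BanachOp.{u} 𝕜 C :=
  sum r (fun n : ℕ => S.copies (n + 1))

/-- The operators `T_α`: `T_0 = T`, `T_{α+1} = (T_α)_+`, and `T_α = (⨁_{ξ < α} T_ξ)_r` for limit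
ordinals `α`. The type `α.ToType` is the index set of all ordinals `ξ < α`. -/
def iter (r : SumExponent) (T : BanachOp.{u} 𝕜 C) (α : Ordinal.{u}) : BanachOp.{u} 𝕜 C :=
  Ordinal.limitRecOn α T (fun _ S => S.plus r)
    (fun o _ S => sum r (fun i : o.ToType => S i.toOrd.1 i.toOrd.2))

end BanachOp

/-- A bounded operator between Banach spaces as a bundled operator. -/
def bundle {𝕜 : Type*} [RCLike 𝕜]
    {E : Type u} [NormedAddCommGroup E] [NormedSpace 𝕜 E] [CompleteSpace E]
    {F : Type u} [NormedAddCommGroup F] [NormedSpace 𝕜 F] [CompleteSpace F]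
    (T : E →L[𝕜] F) : BanachOp.{u} 𝕜 ‖T‖₊ where
  Dom := E
  Cod := F
  op := T
  norm_op_le := le_rfl

end SzlenkOp

end

namespace SzlenkOp

open Order StrongDual WeakDual

/-! ### The derivation, its iterates, and additive closure of the index -/

section Derivation

variable {𝕜 : Type*} [RCLike 𝕜]
  {E : Type u} [NormedAddCommGroup E] [NormedSpace 𝕜 E]
  {F : Type u} [NormedAddCommGroup F] [NormedSpace 𝕜 F]

/-! Write `K` for the weak-star compact convex set `T*(B_{F*})`. Averaging with points of `K` turns
`α` derivations at level `ε` into `α + α` derivations at level `ε / 2`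
(`iterDeriv_half_add_nonempty`), so an index different from `⊤` is additively indecomposable, hence
a power of `ω`.

The index is not `⊤` for Asplund operators (`IsAsplund.index_ne_top`). Otherwise the iterates
stabilise at a nonempty `L ⊆ s_ε(L)`, in which a dyadic tree separated by points of the unit ball of
`E` grows. Lifted to the dual ball of `F`, the tree carries a measure that halves at each step, and
evaluation `F → L_∞(μ)` contradicts the Asplund property. An index at most `1` would make `T`
compact (`isCompactOperator_of_index_le_one`), so `α_T ≠ 0` and it has a last Cantor exponent.

For (i), the dual ball of an `ℓ_1`-sum is the product of the dual balls. Deriving in one coordinate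
after another, `n` copies survive `n` times as long. Thus `S ↦ S_+` raises `ω ^ α` to `ω ^ (α + 1)`
at the same `ε`, and weak-star compactness handles limits (`BanachOp.derived_iter_nonempty`).

For (ii), `T` is carried along as a summand of `T_α`, which gives `≥`. For `≤`, a finite sum costs
at most one factor `ω` (`iterDeriv_finite_sum_eq_empty`) and an arbitrary `c_0`- or `ℓ_r`-sum with
`r > 1` at most two (`iterDeriv_sum_eq_empty`), with an arbitrarily small loss in `ε`. A bound `ω ^
γ` for `T` thus becomes `ω ^ (γ + 3 * (α + 1))` for `T_α` (`BanachOp.IndexBound.iter`). By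
compactness each `Sz_ε(T)` is bounded by some `ω ^ (η_T + δ)` with `δ < ω ^ ζ_T` when `ζ_T ≠ 0`, and
`δ + 3 * (α + 1)` stays below `ω ^ ζ_T`. -/

theorem mem_szDeriv_iff {ε : ℝ} (hε : 0 ≤ ε) {K : Set (StrongDual 𝕜 E)} {x : StrongDual 𝕜 E} :
    x ∈ szDeriv ε K ↔ x ∈ K ∧ ∀ V : Set (WeakDual 𝕜 E), IsOpen V → toWeakDual x ∈ V →
      ∃ y ∈ K, ∃ z ∈ K, toWeakDual y ∈ V ∧ toWeakDual z ∈ V ∧ ε < ‖y - z‖ := by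
  refine and_congr_right fun _ => forall_congr' fun V => forall₂_congr fun _ _ => ?_
  rw [← not_le, Metric.ediam_le_iff]
  push Not
  constructor
  · rintro ⟨y, hy, z, hz, h⟩
    refine ⟨y, hy.1, z, hz.1, hy.2, hz.2, ?_⟩
    rw [edist_dist, ENNReal.ofReal_lt_ofReal_iff_of_nonneg hε, dist_eq_norm] at h
    exact h
  · rintro ⟨y, hy, z, hz, hyV, hzV, h⟩
    refine ⟨y, ⟨hy, hyV⟩, z, ⟨hz, hzV⟩, ?_⟩
    rw [edist_dist, ENNReal.ofReal_lt_ofReal_iff_of_nonneg hε, dist_eq_norm]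
    exact h

theorem notMem_szDeriv {ε : ℝ} (hε : 0 ≤ ε) {K : Set (StrongDual 𝕜 E)} {x : StrongDual 𝕜 E}
    (hx : x ∉ szDeriv ε K) (hxK : x ∈ K) :
    ∃ V : Set (WeakDual 𝕜 E), IsOpen V ∧ toWeakDual x ∈ V ∧
      ∀ y ∈ K, ∀ z ∈ K, toWeakDual y ∈ V → toWeakDual z ∈ V → ‖y - z‖ ≤ ε := by
  rw [mem_szDeriv_iff hε] at hx
  push Not at hx
  exact hx hxK

theorem szDeriv_subset (ε : ℝ) (K : Set (StrongDual 𝕜 E)) : szDeriv ε K ⊆ K := fun _ h => h.1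

theorem isClosed_szDeriv {ε : ℝ} (hε : 0 ≤ ε) {K : Set (StrongDual 𝕜 E)}
    (hK : IsClosed (toStrongDual (𝕜 := 𝕜) ⁻¹' K)) :
    IsClosed (toStrongDual (𝕜 := 𝕜) ⁻¹' szDeriv ε K) := by
  rw [← isOpen_compl_iff, isOpen_iff_forall_mem_open]
  intro x hx
  by_cases hxK : toStrongDual x ∈ K
  · obtain ⟨V, hV, hxV, h⟩ := notMem_szDeriv hε hx hxK
    refine ⟨V, fun y hy hyK => ?_, hV, hxV⟩
    obtain ⟨a, ha, b, hb, haV, hbV, hab⟩ := ((mem_szDeriv_iff hε).1 hyK).2 V hV hy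
    exact absurd (h a ha b hb haV hbV) hab.not_ge
  · exact ⟨(toStrongDual (𝕜 := 𝕜) ⁻¹' K)ᶜ, fun y hy hyK => hy hyK.1, hK.isOpen_compl, hxK⟩

@[simp] theorem iterDeriv_zero (ε : ℝ) (K : Set (StrongDual 𝕜 E)) : iterDeriv ε K 0 = K :=
  Ordinal.limitRecOn_zero _ _ _

theorem iterDeriv_add_one (ε : ℝ) (K : Set (StrongDual 𝕜 E)) (α : Ordinal.{u}) :
    iterDeriv ε K (α + 1) = szDeriv ε (iterDeriv ε K α) :=
  Ordinal.limitRecOn_add_one _ _ _ _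

theorem iterDeriv_limit (ε : ℝ) (K : Set (StrongDual 𝕜 E)) {α : Ordinal.{u}}
    (hα : IsSuccLimit α) : iterDeriv ε K α = ⋂ (β : Ordinal.{u}) (_ : β < α), iterDeriv ε K β :=
  Ordinal.limitRecOn_limit _ _ _ _ hα

theorem iterDeriv_antitone (ε : ℝ) (K : Set (StrongDual 𝕜 E)) : Antitone (iterDeriv ε K) := by
  intro α β h
  induction β using Ordinal.limitRecOn with
  | zero => rw [nonpos_iff_eq_zero.1 h]
  | add_one β ih =>
    rcases h.eq_or_lt with rfl | h
    · rfl
    · rw [iterDeriv_add_one]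
      exact (szDeriv_subset _ _).trans (ih (lt_add_one_iff.1 h))
  | limit β hβ ih =>
    rcases h.eq_or_lt with rfl | h
    · rfl
    · rw [iterDeriv_limit _ _ hβ]
      exact Set.iInter₂_subset α h

theorem isClosed_iterDeriv {ε : ℝ} (hε : 0 ≤ ε) {K : Set (StrongDual 𝕜 E)}
    (hK : IsClosed (toStrongDual (𝕜 := 𝕜) ⁻¹' K)) (α : Ordinal.{u}) :
    IsClosed (toStrongDual (𝕜 := 𝕜) ⁻¹' iterDeriv ε K α) := by
  induction α using Ordinal.limitRecOn with
  | zero => simpa using hK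
  | add_one β ih => rw [iterDeriv_add_one]; exact isClosed_szDeriv hε ih
  | limit β hβ ih =>
    rw [iterDeriv_limit _ _ hβ, Set.preimage_iInter₂]
    exact isClosed_biInter fun i hi => ih i hi

/-- Iterated derivations are preserved by weak-star continuous maps that expand distances. -/
theorem map_mem_iterDeriv {ε a : ℝ} (hε : 0 ≤ ε) (ha : 0 < a) (g : StrongDual 𝕜 E → StrongDual 𝕜 F)
    (hg : Continuous fun w : WeakDual 𝕜 E => toWeakDual (g (toStrongDual w)))
    (hd : ∀ x y, a * ‖x - y‖ ≤ ‖g x - g y‖) {A : Set (StrongDual 𝕜 E)} {B : Set (StrongDual 𝕜 F)}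
    (hAB : ∀ x ∈ A, g x ∈ B) (α : Ordinal.{u}) :
    ∀ x ∈ iterDeriv ε A α, g x ∈ iterDeriv (a * ε) B α := by
  induction α using Ordinal.limitRecOn with
  | zero => simpa using hAB
  | add_one β ih =>
    intro x hx
    rw [iterDeriv_add_one, mem_szDeriv_iff hε] at hx
    rw [iterDeriv_add_one, mem_szDeriv_iff (by positivity)]
    refine ⟨ih x hx.1, fun V hV hxV => ?_⟩
    obtain ⟨y, hy, z, hz, hyV, hzV, h⟩ := hx.2 _ (hV.preimage hg) hxV
    exact ⟨g y, ih y hy, g z, ih z hz, hyV, hzV,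
      (mul_lt_mul_of_pos_left h ha).trans_le (hd y z)⟩
  | limit β hβ ih =>
    intro x hx
    rw [iterDeriv_limit _ _ hβ] at hx ⊢
    simp only [Set.mem_iInter] at hx ⊢
    exact fun i hi => ih i hi x (hx i hi)

theorem szDeriv_mono {ε : ℝ} (hε : 0 ≤ ε) {A B : Set (StrongDual 𝕜 E)} (h : A ⊆ B) :
    szDeriv ε A ⊆ szDeriv ε B := by
  intro x hx
  rw [mem_szDeriv_iff hε] at hx ⊢
  refine ⟨h hx.1, fun V hV hxV => ?_⟩
  obtain ⟨y, hy, z, hz, H⟩ := hx.2 V hV hxV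
  exact ⟨y, h hy, z, h hz, H⟩

theorem iterDeriv_anti_eps {ε ε' : ℝ} (hε : 0 ≤ ε) (h : ε ≤ ε') (A : Set (StrongDual 𝕜 E))
    (α : Ordinal.{u}) : iterDeriv ε' A α ⊆ iterDeriv ε A α := by
  induction α using Ordinal.limitRecOn with
  | zero => simp
  | add_one β ih =>
    rw [iterDeriv_add_one, iterDeriv_add_one]
    refine (szDeriv_mono (hε.trans h) ih).trans fun x hx => ?_
    rw [mem_szDeriv_iff (hε.trans h)] at hx
    rw [mem_szDeriv_iff hε]
    refine ⟨hx.1, fun V hV hxV => ?_⟩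
    obtain ⟨y, hy, z, hz, hyV, hzV, H⟩ := hx.2 V hV hxV
    exact ⟨y, hy, z, hz, hyV, hzV, h.trans_lt H⟩
  | limit β hβ ih =>
    rw [iterDeriv_limit _ _ hβ, iterDeriv_limit _ _ hβ]
    exact Set.iInter₂_mono ih

theorem iterDeriv_add (ε : ℝ) (K : Set (StrongDual 𝕜 E)) (α β : Ordinal.{u}) :
    iterDeriv ε K (α + β) = iterDeriv ε (iterDeriv ε K α) β := by
  induction β using Ordinal.limitRecOn with
  | zero => simp
  | add_one β ih => rw [← add_assoc, iterDeriv_add_one, iterDeriv_add_one, ih]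
  | limit β hβ ih =>
    rw [iterDeriv_limit _ _ hβ, iterDeriv_limit _ _ ((Ordinal.isSuccLimit_add α hβ))]
    ext x
    simp only [Set.mem_iInter]
    constructor
    · intro h i hi
      rw [← ih i hi]
      exact h _ (by gcongr)
    · intro h i hi
      obtain ⟨j, hj, hij⟩ := (Ordinal.lt_add_iff hβ.ne_bot).1 hi
      refine iterDeriv_antitone ε K hij ?_
      rw [ih j hj]
      exact h j hj

/-- The earlier iterates form a decreasing family of nonempty weak-star compact sets. Hence the
first empty iterate never occurs at a limit. -/
theorem iterDeriv_limit_nonempty {ε : ℝ} (hε : 0 ≤ ε) {K : Set (StrongDual 𝕜 E)}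
    (hK : IsCompact (toStrongDual (𝕜 := 𝕜) ⁻¹' K)) {α : Ordinal.{u}} (hα : IsSuccLimit α)
    (h : ∀ β < α, (iterDeriv ε K β).Nonempty) : (iterDeriv ε K α).Nonempty := by
  have hcl := isClosed_iterDeriv hε hK.isClosed
  have : Nonempty (Set.Iio α) := ⟨⟨0, hα.bot_lt⟩⟩
  have := IsCompact.nonempty_iInter_of_directed_nonempty_isCompact_isClosed
    (fun β : Set.Iio α => toStrongDual (𝕜 := 𝕜) ⁻¹' iterDeriv ε K β.1)
    (fun a b => by
      rcases le_total a b with hab | hab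
      · exact ⟨b, Set.preimage_mono (iterDeriv_antitone ε K hab), subset_rfl⟩
      · exact ⟨a, subset_rfl, Set.preimage_mono (iterDeriv_antitone ε K hab)⟩)
    (fun β => h β.1 β.2)
    (fun β => hK.of_isClosed_subset (hcl _) (Set.preimage_mono (by
      simpa using iterDeriv_antitone ε K (zero_le (a := β.1)))))
    (fun β => hcl _)
  obtain ⟨x, hx⟩ := this
  refine ⟨toStrongDual x, ?_⟩
  rw [iterDeriv_limit _ _ hα]
  simp only [Set.mem_iInter] at hx ⊢
  exact fun i hi => hx ⟨i, hi⟩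

theorem lt_epsIndexSet_iff {ε : ℝ} {K : Set (StrongDual 𝕜 E)} {α : Ordinal.{u}} :
    (α : WithTop Ordinal.{u}) < epsIndexSet ε K ↔ (iterDeriv ε K α).Nonempty := by
  constructor
  · intro h
    by_contra hne
    rw [Set.not_nonempty_iff_eq_empty] at hne
    exact h.not_ge (iInf₂_le α hne)
  · intro h
    by_contra hlt
    rw [not_lt] at hlt
    have : epsIndexSet ε K < ((α + 1 : Ordinal.{u}) : WithTop Ordinal.{u}) :=
      hlt.trans_lt (WithTop.coe_lt_coe.2 (lt_add_one α))
    simp only [epsIndexSet, iInf_lt_iff] at this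
    obtain ⟨β, hβ, hβα⟩ := this
    have := iterDeriv_antitone ε K (lt_add_one_iff.1 (WithTop.coe_lt_coe.1 hβα))
    rw [hβ] at this
    exact h.ne_empty (Set.subset_eq_empty this rfl)

theorem epsIndexSet_le_iff {ε : ℝ} {K : Set (StrongDual 𝕜 E)} {α : Ordinal.{u}} :
    epsIndexSet ε K ≤ (α : WithTop Ordinal.{u}) ↔ iterDeriv ε K α = ∅ := by
  rw [← not_lt, lt_epsIndexSet_iff, Set.not_nonempty_iff_eq_empty]

/-- An ordinal-valued function that locally does not increase, and whose level sets are locally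
of diameter at most `ε`, bounds the derivation rank from above. -/
theorem le_of_mem_iterDeriv {ε : ℝ} (hε : 0 ≤ ε) {K : Set (StrongDual 𝕜 E)}
    {W : Set (WeakDual 𝕜 E)} (hW : IsOpen W) (Φ : StrongDual 𝕜 E → Ordinal.{u})
    (hΦ : ∀ x ∈ K, toWeakDual x ∈ W → ∃ V : Set (WeakDual 𝕜 E), IsOpen V ∧ toWeakDual x ∈ V ∧
      (∀ y ∈ K, toWeakDual y ∈ V → toWeakDual y ∈ W → Φ y ≤ Φ x) ∧
      ∀ y ∈ K, ∀ z ∈ K, toWeakDual y ∈ V → toWeakDual z ∈ V → toWeakDual y ∈ W →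
        toWeakDual z ∈ W → Φ y = Φ x → Φ z = Φ x → ‖y - z‖ ≤ ε) (α : Ordinal.{u}) :
    ∀ x ∈ iterDeriv ε K α, toWeakDual x ∈ W → α ≤ Φ x := by
  have hsub : ∀ α, iterDeriv ε K α ⊆ K := fun α => by
    simpa using iterDeriv_antitone ε K (zero_le (a := α))
  induction α using Ordinal.limitRecOn with
  | zero => simp
  | add_one β ih =>
    intro x hx hxW
    rw [iterDeriv_add_one, mem_szDeriv_iff hε] at hx
    obtain ⟨V, hV, hxV, h1, h2⟩ := hΦ x (hsub _ hx.1) hxW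
    refine add_one_le_of_lt ((ih x hx.1 hxW).lt_of_ne fun hβ => ?_)
    obtain ⟨y, hy, z, hz, hyV, hzV, hyz⟩ := hx.2 (V ∩ W) (hV.inter hW) ⟨hxV, hxW⟩
    refine hyz.not_ge (h2 y (hsub _ hy) z (hsub _ hz) hyV.1 hzV.1 hyV.2 hzV.2 ?_ ?_)
    · exact (h1 y (hsub _ hy) hyV.1 hyV.2).antisymm (hβ ▸ ih y hy hyV.2)
    · exact (h1 z (hsub _ hz) hzV.1 hzV.2).antisymm (hβ ▸ ih z hz hzV.2)
  | limit β hβ ih =>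
    intro x hx hxW
    rw [iterDeriv_limit _ _ hβ] at hx
    simp only [Set.mem_iInter] at hx
    exact hβ.le_iff_forall_le.2 fun i hi => ih i hi x (hx i hi) hxW

/-! ### The image of the dual ball -/

theorem mem_dualBallImage {T : E →L[𝕜] F} {x : StrongDual 𝕜 E} :
    x ∈ dualBallImage T ↔ ∃ φ : StrongDual 𝕜 F, ‖φ‖ ≤ 1 ∧ φ.comp T = x := by
  simp [dualBallImage]

theorem zero_mem_dualBallImage (T : E →L[𝕜] F) : 0 ∈ dualBallImage T :=
  mem_dualBallImage.2 ⟨0, by simp, by simp⟩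

theorem continuous_weakDual_comp (T : E →L[𝕜] F) :
    Continuous fun w : WeakDual 𝕜 F => toWeakDual ((toStrongDual w).comp T) :=
  WeakDual.continuous_of_continuous_eval fun x => WeakDual.eval_continuous (T x)

theorem isCompact_dualBallImage (T : E →L[𝕜] F) :
    IsCompact (toStrongDual (𝕜 := 𝕜) ⁻¹' dualBallImage T) := by
  convert (WeakDual.isCompact_closedBall (0 : StrongDual 𝕜 F) 1).image (continuous_weakDual_comp T)
  ext x
  simp only [Set.mem_preimage, dualBallImage, Set.mem_image]
  constructor
  · rintro ⟨φ, h, hx⟩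
    exact ⟨toWeakDual φ, h, by simp [hx]⟩
  · rintro ⟨φ, h, rfl⟩
    exact ⟨toStrongDual φ, h, rfl⟩

theorem norm_le_of_mem_dualBallImage {T : E →L[𝕜] F} {x : StrongDual 𝕜 E}
    (hx : x ∈ dualBallImage T) : ‖x‖ ≤ ‖T‖ := by
  obtain ⟨φ, hφ, rfl⟩ := mem_dualBallImage.1 hx
  exact (φ.opNorm_comp_le T).trans (mul_le_of_le_one_left (norm_nonneg _) hφ)

theorem lt_epsIndex_iff {ε : ℝ} {T : E →L[𝕜] F} {α : Ordinal.{u}} :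
    (α : WithTop Ordinal.{u}) < epsIndex ε T ↔ (iterDeriv ε (dualBallImage T) α).Nonempty :=
  lt_epsIndexSet_iff

theorem epsIndex_le_iff {ε : ℝ} {T : E →L[𝕜] F} {α : Ordinal.{u}} :
    epsIndex ε T ≤ (α : WithTop Ordinal.{u}) ↔ iterDeriv ε (dualBallImage T) α = ∅ :=
  epsIndexSet_le_iff

theorem lt_index_iff {T : E →L[𝕜] F} {α : Ordinal.{u}} :
    (α : WithTop Ordinal.{u}) < index T ↔
      ∃ ε > 0, (iterDeriv ε (dualBallImage T) α).Nonempty := by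
  simp only [index, lt_iSup_iff, lt_epsIndex_iff, exists_prop, gt_iff_lt]

theorem index_le_iff {T : E →L[𝕜] F} {α : Ordinal.{u}} :
    index T ≤ (α : WithTop Ordinal.{u}) ↔ ∀ ε > 0, iterDeriv ε (dualBallImage T) α = ∅ := by
  simp only [index, iSup_le_iff, epsIndex_le_iff, gt_iff_lt]

theorem continuous_weakDual_smul_add (c : 𝕜) (f : StrongDual 𝕜 E) :
    Continuous fun w : WeakDual 𝕜 E => toWeakDual (c • toStrongDual w + f) :=
  WeakDual.continuous_of_continuous_eval fun x =>
    ((WeakDual.eval_continuous x).const_smul c).add continuous_const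

theorem half_add_half_mem {T : E →L[𝕜] F} {x y : StrongDual 𝕜 E} (hx : x ∈ dualBallImage T)
    (hy : y ∈ dualBallImage T) : (2⁻¹ : 𝕜) • x + (2⁻¹ : 𝕜) • y ∈ dualBallImage T := by
  obtain ⟨φ, hφ, rfl⟩ := mem_dualBallImage.1 hx
  obtain ⟨ψ, hψ, rfl⟩ := mem_dualBallImage.1 hy
  refine mem_dualBallImage.2 ⟨(2⁻¹ : 𝕜) • φ + (2⁻¹ : 𝕜) • ψ, ?_, ?_⟩
  · refine (norm_add_le _ _).trans ?_
    rw [norm_smul, norm_smul]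
    norm_num
    linarith
  · ext; simp

theorem smul_mem_dualBallImage {T : E →L[𝕜] F} {x : StrongDual 𝕜 E} (hx : x ∈ dualBallImage T)
    {c : 𝕜} (hc : ‖c‖ ≤ 1) : c • x ∈ dualBallImage T := by
  obtain ⟨φ, hφ, rfl⟩ := mem_dualBallImage.1 hx
  refine mem_dualBallImage.2 ⟨c • φ, ?_, by ext; simp⟩
  rw [norm_smul]
  exact mul_le_one₀ hc (norm_nonneg _) hφ

/-! ### The Szlenk index is a power of `ω` -/

/-- For fixed `y ∈ K` the map `x ↦ (x + y) / 2` sends `K` into `K` and halves distances, so it sends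
`z` to a point of the `α`-th iterate at `ε / 2`. Since this holds for all `y ∈ K`, the map `y ↦ (z +
y) / 2` sends `K` into that iterate, and applying it to `z` gives `α` further derivations. -/
theorem iterDeriv_half_add_nonempty {ε : ℝ} (hε : 0 ≤ ε) {T : E →L[𝕜] F} {α : Ordinal.{u}}
    (h : (iterDeriv ε (dualBallImage T) α).Nonempty) :
    (iterDeriv (2⁻¹ * ε) (dualBallImage T) (α + α)).Nonempty := by
  obtain ⟨z, hz⟩ := h
  set K := dualBallImage T
  have hsub : iterDeriv ε K α ⊆ K := by simpa using iterDeriv_antitone ε K (zero_le (a := α))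
  have key : ∀ f : StrongDual 𝕜 E, ∀ A B : Set (StrongDual 𝕜 E),
      (∀ x ∈ A, (2⁻¹ : 𝕜) • x + (2⁻¹ : 𝕜) • f ∈ B) →
      ∀ x ∈ iterDeriv ε A α, (2⁻¹ : 𝕜) • x + (2⁻¹ : 𝕜) • f ∈ iterDeriv (2⁻¹ * ε) B α := by
    intro f A B h
    refine map_mem_iterDeriv hε (by norm_num) (fun x => (2⁻¹ : 𝕜) • x + (2⁻¹ : 𝕜) • f)
      (continuous_weakDual_smul_add _ _) (fun x y => ?_) h α
    rw [add_sub_add_right_eq_sub, ← smul_sub (2⁻¹ : 𝕜) x y, norm_smul]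
    norm_num
  rw [iterDeriv_add]
  refine ⟨_, key z K _ (fun y hy => ?_) z hz⟩
  rw [add_comm]
  exact key y K K (fun x hx => half_add_half_mem hx hy) z hz

/-- Halving `ε` is harmless in a supremum over all `ε > 0`, so the ordinals below the index are
closed under doubling, hence under addition. -/
theorem exists_index_eq_opow {T : E →L[𝕜] F} (h : index T ≠ ⊤) :
    ∃ α : Ordinal.{u}, index T = ((ω ^ α : Ordinal.{u}) : WithTop Ordinal.{u}) := by
  obtain ⟨o, ho⟩ := WithTop.ne_top_iff_exists.1 h
  have hp : Ordinal.IsPrincipal (· + ·) o := by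
    rw [Ordinal.isPrincipal_add_iff_add_self_lt]
    intro b hb
    rw [← WithTop.coe_lt_coe, ho, lt_index_iff] at hb ⊢
    obtain ⟨ε, hε, hne⟩ := hb
    exact ⟨2⁻¹ * ε, by positivity, iterDeriv_half_add_nonempty hε.le hne⟩
  rcases Ordinal.isPrincipal_add_iff_zero_or_omega0_opow.1 hp with rfl | ⟨α, rfl⟩
  · have : ((0 : Ordinal.{u}) : WithTop Ordinal.{u}) < index T :=
      lt_index_iff.2 ⟨1, one_pos, 0, by simpa using zero_mem_dualBallImage T⟩
    exact absurd ho this.ne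
  · exact ⟨α, ho.symm⟩

theorem index_eq_opow_alphaOf {T : E →L[𝕜] F} (h : index T ≠ ⊤) :
    index T = ((ω ^ alphaOf T : Ordinal.{u}) : WithTop Ordinal.{u}) :=
  csInf_mem (s := {α : Ordinal.{u} | index T = ((ω ^ α : Ordinal.{u}) : WithTop Ordinal.{u})})
    (exists_index_eq_opow h)

theorem index_ne_top {T : E →L[𝕜] F}
    (h : ∀ ε > 0, ∃ α, iterDeriv ε (dualBallImage T) α = ∅) : index T ≠ ⊤ := by
  choose! f hf using h
  -- The values `ε` form a small set, so one ordinal serves all of them.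
  have hb : BddAbove (Set.range fun ε : ℝ => f ε) := Ordinal.bddAbove_of_small
  refine ((index_le_iff (α := ⨆ ε, f ε)).2 fun ε hε => ?_).trans_lt (WithTop.coe_lt_top _) |>.ne
  have := iterDeriv_antitone ε (dualBallImage T) (le_ciSup hb ε)
  rw [hf ε hε] at this
  exact Set.subset_eq_empty this rfl

end Derivation

/-- The least nonzero tail of `α` is additively indecomposable: if it were `b + c` with both terms
smaller, then `c` would be a smaller nonzero tail. -/
theorem exists_eq_add_opow {α : Ordinal.{u}} (hα : α ≠ 0) : ∃ ζ η : Ordinal.{u}, α = η + ω ^ ζ := by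
  let S : Set Ordinal.{u} := {ρ | ρ ≠ 0 ∧ ∃ η, α = η + ρ}
  have hS : S.Nonempty := ⟨α, hα, 0, by simp⟩
  obtain ⟨h0, η, hη⟩ := csInf_mem hS
  have hp : Ordinal.IsPrincipal (· + ·) (sInf S) := by
    rw [Ordinal.isPrincipal_add_iff_add_lt_ne_self]
    intro b hb c hc hbc
    have hc0 : c ≠ 0 := by
      rintro rfl
      rw [add_zero] at hbc
      exact hb.ne hbc
    refine hc.not_ge (csInf_le' ⟨hc0, η + b, ?_⟩)
    rw [add_assoc, hbc, hη]
  rcases Ordinal.isPrincipal_add_iff_zero_or_omega0_opow.1 hp with h | ⟨ζ, hζ⟩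
  · exact absurd h h0
  · exact ⟨ζ, η, by rw [hη]; simp only at hζ; rw [hζ]⟩

end SzlenkOp

namespace SzlenkOp

open Order

/-! ### Natural sums of ordinals -/

section NaturalSum

/-- The natural (Hessenberg) sum of ordinals. -/
noncomputable def natAdd (a b : Ordinal.{u}) : Ordinal.{u} :=
  max (⨆ x : Set.Iio a, succ (natAdd x.1 b)) (⨆ x : Set.Iio b, succ (natAdd a x.1))
termination_by (a, b)
decreasing_by
  · exact Prod.Lex.left _ _ x.2
  · exact Prod.Lex.right _ x.2

theorem natAdd_le_iff {a b c : Ordinal.{u}} :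
    natAdd a b ≤ c ↔ (∀ x < a, natAdd x b < c) ∧ ∀ y < b, natAdd a y < c := by
  rw [natAdd, max_le_iff, ciSup_le_iff' Ordinal.bddAbove_of_small,
    ciSup_le_iff' Ordinal.bddAbove_of_small]
  simp

theorem natAdd_lt_natAdd_right {a x : Ordinal.{u}} (h : x < a) (b : Ordinal.{u}) :
    natAdd x b < natAdd a b :=
  (natAdd_le_iff.1 le_rfl).1 x h

theorem natAdd_lt_natAdd_left {b y : Ordinal.{u}} (a : Ordinal.{u}) (h : y < b) :
    natAdd a y < natAdd a b :=
  (natAdd_le_iff.1 le_rfl).2 y h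

theorem natAdd_le_natAdd {a b c d : Ordinal.{u}} (h : a ≤ c) (h' : b ≤ d) :
    natAdd a b ≤ natAdd c d :=
  calc natAdd a b ≤ natAdd c b := by
        rcases h.eq_or_lt with rfl | h
        exacts [le_rfl, (natAdd_lt_natAdd_right h b).le]
    _ ≤ natAdd c d := by
        rcases h'.eq_or_lt with rfl | h'
        exacts [le_rfl, (natAdd_lt_natAdd_left c h').le]

/-- This rigidity is the reason for natural sums: ordinary addition is not strictly increasing in
its left argument. It lets equality of total ranks pass to each coordinate. -/
theorem natAdd_eq_natAdd {a b c d : Ordinal.{u}} (h : a ≤ c) (h' : b ≤ d)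
    (H : natAdd a b = natAdd c d) : a = c ∧ b = d := by
  constructor
  · by_contra hne
    exact ((natAdd_lt_natAdd_right (h.lt_of_ne hne) b).trans_le
      (natAdd_le_natAdd le_rfl h')).ne H
  · by_contra hne
    exact ((natAdd_le_natAdd h le_rfl).trans_lt
      (natAdd_lt_natAdd_left c (h'.lt_of_ne hne))).ne H

theorem eq_mul_add_of_lt {P x a : Ordinal.{u}} {n : ℕ} (hP : P ≠ 0) (ha : a < P)
    (h : x < P * n + a) :
    ∃ (k : ℕ) (c : Ordinal.{u}), x = P * k + c ∧ c < P ∧ (k < n ∨ k = n ∧ c < a) := by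
  have hlt : x / P < (n + 1 : ℕ) := by
    rw [← Ordinal.lt_mul_iff_div_lt hP]
    refine h.trans ?_
    push_cast
    rw [mul_add_one]
    gcongr
  obtain ⟨k, hk⟩ := Ordinal.lt_omega0.1 (hlt.trans (Ordinal.natCast_lt_omega0 _))
  have hx : x = P * k + x % P := by rw [← hk, Ordinal.div_add_mod]
  refine ⟨k, x % P, hx, Ordinal.mod_lt x hP, ?_⟩
  rw [hk, Nat.cast_lt, Nat.lt_succ_iff] at hlt
  rcases hlt.eq_or_lt with rfl | hlt
  · right
    refine ⟨rfl, ?_⟩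
    rw [hx] at h
    exact lt_of_add_lt_add_left h
  · exact Or.inl hlt

theorem mul_add_lt_mul_add {P c d : Ordinal.{u}} {k n : ℕ} (hc : c < P) (h : k < n) :
    P * k + c < P * n + d := by
  calc P * k + c < P * k + P := by gcongr
    _ = P * (k + 1 : ℕ) := by push_cast; rw [mul_add_one]
    _ ≤ P * n := by gcongr; exact_mod_cast h
    _ ≤ P * n + d := le_self_add

/-- Lowering one argument either drops a full multiple of `P`, which outweighs any remainder because
`P` is closed under natural sums, or lowers the remainder, where strict monotonicity applies. -/
theorem natAdd_mul_add_le {P : Ordinal.{u}} (hP0 : P ≠ 0)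
    (hP : ∀ a < P, ∀ b < P, natAdd a b < P) (n m : ℕ) (a b : Ordinal.{u})
    (ha : a < P) (hb : b < P) :
    natAdd (P * n + a) (P * m + b) ≤ P * (n + m : ℕ) + natAdd a b := by
  rw [natAdd_le_iff]
  constructor
  · intro x hx
    obtain ⟨k, c, rfl, hc, h⟩ := eq_mul_add_of_lt hP0 ha hx
    refine (natAdd_mul_add_le hP0 hP k m c b hc hb).trans_lt ?_
    rcases h with h | ⟨rfl, h⟩
    · exact mul_add_lt_mul_add (hP c hc b hb) (by lia)
    · have := natAdd_lt_natAdd_right h b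
      gcongr
  · intro x hx
    obtain ⟨k, c, rfl, hc, h⟩ := eq_mul_add_of_lt hP0 hb hx
    refine (natAdd_mul_add_le hP0 hP n k a c ha hc).trans_lt ?_
    rcases h with h | ⟨rfl, h⟩
    · exact mul_add_lt_mul_add (hP a ha c hc) (by lia)
    · have := natAdd_lt_natAdd_left a h
      gcongr
termination_by (P * n + a, P * m + b)
decreasing_by
  · exact Prod.Lex.left _ _ hx
  · exact Prod.Lex.right _ hx

theorem natAdd_lt_opow (γ : Ordinal.{u}) :
    ∀ a < ω ^ γ, ∀ b < ω ^ γ, natAdd a b < ω ^ γ := by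
  induction γ using Ordinal.limitRecOn with
  | zero =>
    intro a ha b hb
    rw [Ordinal.opow_zero, Order.lt_one_iff] at *
    subst ha hb
    rw [← nonpos_iff_eq_zero, natAdd_le_iff]
    simp
  | add_one γ ih =>
    intro a ha b hb
    obtain ⟨n, hn⟩ := Ordinal.lt_omega0_opow_succ.1 (by simpa using ha)
    obtain ⟨m, hm⟩ := Ordinal.lt_omega0_opow_succ.1 (by simpa using hb)
    have hP : (ω : Ordinal.{u}) ^ γ ≠ 0 := (Ordinal.opow_pos _ Ordinal.omega0_pos).ne'
    have h0 : (0 : Ordinal.{u}) < ω ^ γ := pos_iff_ne_zero.2 hP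
    have := natAdd_mul_add_le hP ih n m 0 0 h0 h0
    rw [add_zero, add_zero] at this
    refine ((natAdd_le_natAdd hn.le hm.le).trans this).trans_lt ?_
    have h2 := mul_add_lt_mul_add (d := 0) (ih 0 h0 0 h0) (Nat.lt_succ_self (n + m))
    refine h2.trans ?_
    rw [add_zero, Ordinal.opow_add, Ordinal.opow_one]
    gcongr
    · exact Ordinal.natCast_lt_omega0 _
  | limit γ hγ ih =>
    intro a ha b hb
    rw [Ordinal.lt_opow_of_isSuccLimit Ordinal.omega0_ne_zero hγ] at ha hb
    obtain ⟨γ₁, h₁, ha⟩ := ha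
    obtain ⟨γ₂, h₂, hb⟩ := hb
    have hm : max γ₁ γ₂ < γ := max_lt h₁ h₂
    have hmono {x y : Ordinal.{u}} (h : x ≤ y) : (ω : Ordinal.{u}) ^ x ≤ ω ^ y :=
      Ordinal.opow_le_opow_right Ordinal.omega0_pos h
    exact (ih _ hm a (ha.trans_le (hmono (le_max_left _ _))) b
      (hb.trans_le (hmono (le_max_right _ _)))).trans_le (hmono hm.le)

/-- For every finite set `s` there is a strictly monotone ordinal-valued function of families of
ordinals indexed by `s` that does not lead out of the powers of `ω`. -/
theorem exists_strictMono_sum {ι : Type*} (s : Finset ι) :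
    ∃ Φ : (ι → Ordinal.{u}) → Ordinal.{u},
      (∀ f g, (∀ i ∈ s, f i ≤ g i) → Φ f ≤ Φ g ∧ (Φ f = Φ g → ∀ i ∈ s, f i = g i)) ∧
      ∀ (γ : Ordinal.{u}) (f), (∀ i ∈ s, f i < ω ^ γ) → Φ f < ω ^ γ := by
  classical
  induction s using Finset.induction_on with
  | empty => exact ⟨fun _ => 0, by simp, fun γ f _ => Ordinal.opow_pos _ Ordinal.omega0_pos⟩
  | insert i s his ih =>
    obtain ⟨Φ, h1, h2⟩ := ih
    refine ⟨fun f => natAdd (f i) (Φ f), fun f g h => ?_, fun γ f h => ?_⟩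
    · rw [Finset.forall_mem_insert] at h
      have h3 := h1 f g h.2
      refine ⟨natAdd_le_natAdd h.1 h3.1, fun H => ?_⟩
      have h4 := natAdd_eq_natAdd h.1 h3.1 H
      rw [Finset.forall_mem_insert]
      exact ⟨h4.1, h3.2 h4.2⟩
    · rw [Finset.forall_mem_insert] at h
      exact natAdd_lt_opow γ _ h.1 _ (h2 γ f h.2)

end NaturalSum

end SzlenkOp

namespace SzlenkOp

open Order StrongDual WeakDual

theorem SumExponent.norm_ne_zero (p : SumExponent) : p.norm ≠ 0 :=
  (zero_lt_one.trans_le (Fact.out : 1 ≤ p.norm)).ne'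

theorem SumExponent.toReal_norm {p : SumExponent} (hp : p.1 ≠ 0) : p.norm.toReal = p.1 := by
  have h1 : 1 ≤ p.1 := p.2.resolve_left hp
  rw [SumExponent.norm, if_neg hp, ENNReal.toReal_ofReal (by linarith)]

/-! ### Coordinates, truncations and functionals on direct sums -/

section Coordinates

variable {𝕜 : Type*} [RCLike 𝕜] {ι : Type v}
  {E : ι → Type u} [∀ i, NormedAddCommGroup (E i)] [∀ i, NormedSpace 𝕜 (E i)]
  {F : ι → Type u} [∀ i, NormedAddCommGroup (F i)] [∀ i, NormedSpace 𝕜 (F i)]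
  {p : SumExponent}

variable (𝕜 E p) in
/-- The coordinate projections of a direct sum. -/
noncomputable def coord (i : ι) : directSum 𝕜 E p →L[𝕜] E i :=
  (lp.evalCLM 𝕜 E p.norm i).comp (directSum 𝕜 E p).subtypeL

theorem ext_coord {x y : directSum 𝕜 E p} (h : ∀ i, coord 𝕜 E p i x = coord 𝕜 E p i y) :
    x = y :=
  Subtype.ext (lp.ext (funext h))

open Classical in
variable (𝕜 E p) in
/-- The coordinate embeddings into a direct sum. -/
noncomputable def emb (i : ι) : E i →L[𝕜] directSum 𝕜 E p :=
  (lp.singleContinuousLinearMap 𝕜 E p.norm i).codRestrict (directSum 𝕜 E p) fun a => by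
    change Filter.Tendsto (fun j => ‖lp.single p.norm i a j‖) Filter.cofinite (𝓝 0)
    refine tendsto_const_nhds.congr' ?_
    have : ∀ᶠ j in Filter.cofinite, j ≠ i := (Set.finite_singleton i).eventually_cofinite_notMem
    filter_upwards [this] with j hj
    simp [hj]

theorem coord_emb_same (i : ι) (a : E i) : coord 𝕜 E p i (emb 𝕜 E p i a) = a := by
  classical
  exact lp.single_apply_self p.norm i a

theorem coord_emb_ne {i j : ι} (h : j ≠ i) (a : E i) : coord 𝕜 E p j (emb 𝕜 E p i a) = 0 := by
  classical
  exact lp.single_apply_ne p.norm i a h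

theorem norm_emb (i : ι) (a : E i) : ‖emb 𝕜 E p i a‖ = ‖a‖ := by
  classical
  exact lp.norm_single (pos_iff_ne_zero.2 p.norm_ne_zero) i a

theorem norm_coord_le (i : ι) (x : directSum 𝕜 E p) : ‖coord 𝕜 E p i x‖ ≤ ‖x‖ :=
  lp.norm_apply_le_norm p.norm_ne_zero _ i

theorem norm_le_norm_of_coord {x : directSum 𝕜 E p} {y : directSum 𝕜 F p}
    (h : ∀ i, ‖coord 𝕜 E p i x‖ ≤ ‖coord 𝕜 F p i y‖) : ‖x‖ ≤ ‖y‖ :=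
  lp.norm_mono p.norm_ne_zero h

variable (𝕜 E p) in
/-- The projection onto finitely many coordinates of a direct sum. -/
noncomputable def trunc (R : Finset ι) : directSum 𝕜 E p →L[𝕜] directSum 𝕜 E p :=
  ∑ i ∈ R, (emb 𝕜 E p i).comp (coord 𝕜 E p i)

theorem trunc_apply (R : Finset ι) (x : directSum 𝕜 E p) :
    trunc 𝕜 E p R x = ∑ i ∈ R, emb 𝕜 E p i (coord 𝕜 E p i x) := by
  simp [trunc]

theorem coord_sum_emb_of_mem {R : Finset ι} (f : ∀ i, E i) {j : ι} (h : j ∈ R) :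
    coord 𝕜 E p j (∑ i ∈ R, emb 𝕜 E p i (f i)) = f j := by
  rw [map_sum, Finset.sum_eq_single j, coord_emb_same]
  · exact fun i _ hij => coord_emb_ne hij.symm _
  · exact fun hj => absurd h hj

theorem coord_sum_emb_of_notMem {R : Finset ι} (f : ∀ i, E i) {j : ι} (h : j ∉ R) :
    coord 𝕜 E p j (∑ i ∈ R, emb 𝕜 E p i (f i)) = 0 := by
  rw [map_sum]
  refine Finset.sum_eq_zero fun i hi => coord_emb_ne (fun hij => h (by rwa [hij])) _

theorem coord_trunc_of_mem {R : Finset ι} (x : directSum 𝕜 E p) {j : ι} (h : j ∈ R) :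
    coord 𝕜 E p j (trunc 𝕜 E p R x) = coord 𝕜 E p j x := by
  rw [trunc_apply, coord_sum_emb_of_mem (fun i => coord 𝕜 E p i x) h]

theorem coord_trunc_of_notMem {R : Finset ι} (x : directSum 𝕜 E p) {j : ι} (h : j ∉ R) :
    coord 𝕜 E p j (trunc 𝕜 E p R x) = 0 := by
  rw [trunc_apply, coord_sum_emb_of_notMem (fun i => coord 𝕜 E p i x) h]

theorem norm_trunc_apply_le (R : Finset ι) (x : directSum 𝕜 E p) : ‖trunc 𝕜 E p R x‖ ≤ ‖x‖ := by
  refine norm_le_norm_of_coord fun j => ?_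
  by_cases h : j ∈ R
  · rw [coord_trunc_of_mem x h]
  · rw [coord_trunc_of_notMem x h, norm_zero]
    exact norm_nonneg _

theorem norm_sub_trunc_apply_le (R : Finset ι) (x : directSum 𝕜 E p) :
    ‖x - trunc 𝕜 E p R x‖ ≤ ‖x‖ := by
  refine norm_le_norm_of_coord fun j => ?_
  rw [map_sub]
  by_cases h : j ∈ R
  · rw [coord_trunc_of_mem x h, sub_self, norm_zero]
    exact norm_nonneg _
  · rw [coord_trunc_of_notMem x h, sub_zero]

theorem trunc_univ [Fintype ι] (x : directSum 𝕜 E p) : trunc 𝕜 E p Finset.univ x = x :=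
  ext_coord fun j => coord_trunc_of_mem x (Finset.mem_univ j)

theorem tendsto_trunc (x : directSum 𝕜 E p) :
    Filter.Tendsto (fun R => trunc 𝕜 E p R x) Filter.atTop (𝓝 x) := by
  classical
  by_cases hp : p.1 = 0
  · rw [Metric.tendsto_atTop]
    intro δ hδ
    have hx : Filter.Tendsto (fun i => ‖(x : lp E p.norm) i‖) Filter.cofinite (𝓝 0) := x.2
    have hfin : {i | ¬ ‖(x : lp E p.norm) i‖ < δ / 2}.Finite :=
      Filter.eventually_cofinite.1 (hx.eventually (gt_mem_nhds (half_pos hδ)))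
    refine ⟨hfin.toFinset, fun R hR => ?_⟩
    have key : ∀ j, ‖coord 𝕜 E p j (trunc 𝕜 E p R x - x)‖ ≤ δ / 2 := by
      intro j
      rw [map_sub]
      by_cases h : j ∈ R
      · rw [coord_trunc_of_mem x h, sub_self, norm_zero]
        positivity
      · rw [coord_trunc_of_notMem x h, zero_sub, norm_neg]
        by_contra hlt
        exact h (hR (hfin.mem_toFinset.2 fun h' => hlt h'.le))
    rw [dist_eq_norm]
    refine lt_of_le_of_lt ?_ (half_lt_self hδ)
    have hn : p.norm = ∞ := by simp [SumExponent.norm, hp]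
    -- The exponent occurs in the type of the vector, so the vector is made a variable before the
    -- exponent is rewritten to `∞`.
    generalize trunc 𝕜 E p R x - x = y at key ⊢
    obtain ⟨y, hy⟩ := y
    change ‖y‖ ≤ δ / 2
    change ∀ j, ‖y j‖ ≤ δ / 2 at key
    clear hy
    revert y
    rw [hn]
    exact fun y hy => lp.norm_le_of_forall_le (half_pos hδ).le hy
  · rw [tendsto_subtype_rng]
    have := lp.hasSum_single (E := E) (p := p.norm) (by simp [SumExponent.norm, hp]) (x : lp E p.norm)
    refine this.congr fun R => ?_
    rw [trunc_apply, Submodule.coe_sum]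
    rfl

/-- Coefficients for which disjointly supported vectors of the unit ball combine to a vector of the
unit ball. -/
def Admissible (p : SumExponent) (a b : ℝ) : Prop :=
  0 ≤ a ∧ 0 ≤ b ∧ (p.1 = 0 → a ≤ 1 ∧ b ≤ 1) ∧ (p.1 ≠ 0 → a ^ p.1 + b ^ p.1 ≤ 1)

theorem norm_combine_le {a b : ℝ} (hab : Admissible p a b) (R : Finset ι)
    {y z : directSum 𝕜 E p} (hy : ‖y‖ ≤ 1) (hz : ‖z‖ ≤ 1)
    (hyR : ∀ i ∉ R, coord 𝕜 E p i y = 0) (hzR : ∀ i ∈ R, coord 𝕜 E p i z = 0) :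
    ‖(a : 𝕜) • y + (b : 𝕜) • z‖ ≤ 1 := by
  obtain ⟨ha, hb, h0, h1⟩ := hab
  have hc1 : ∀ i ∈ R, ‖coord 𝕜 E p i ((a : 𝕜) • y + (b : 𝕜) • z)‖ = a * ‖coord 𝕜 E p i y‖ := by
    intro i hi
    rw [map_add, map_smul, map_smul, hzR i hi, smul_zero, add_zero, norm_smul, RCLike.norm_ofReal,
      abs_of_nonneg ha]
  have hc2 : ∀ i ∉ R, ‖coord 𝕜 E p i ((a : 𝕜) • y + (b : 𝕜) • z)‖ = b * ‖coord 𝕜 E p i z‖ := by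
    intro i hi
    rw [map_add, map_smul, map_smul, hyR i hi, smul_zero, zero_add, norm_smul, RCLike.norm_ofReal,
      abs_of_nonneg hb]
  by_cases hp : p.1 = 0
  · obtain ⟨ha1, hb1⟩ := h0 hp
    have key : ∀ i, ‖coord 𝕜 E p i ((a : 𝕜) • y + (b : 𝕜) • z)‖ ≤ 1 := by
      intro i
      by_cases hi : i ∈ R
      · rw [hc1 i hi]
        exact mul_le_one₀ ha1 (norm_nonneg _) ((norm_coord_le i y).trans hy)
      · rw [hc2 i hi]
        exact mul_le_one₀ hb1 (norm_nonneg _) ((norm_coord_le i z).trans hz)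
    have hn : p.norm = ∞ := by simp [SumExponent.norm, hp]
    generalize (a : 𝕜) • y + (b : 𝕜) • z = w at key ⊢
    obtain ⟨w, hw⟩ := w
    change ‖w‖ ≤ 1
    change ∀ j, ‖w j‖ ≤ 1 at key
    clear * - key hn
    revert w
    rw [hn]
    exact fun y hy => lp.norm_le_of_forall_le zero_le_one hy
  · have hp1 : 1 ≤ p.1 := p.2.resolve_left hp
    have hr := SumExponent.toReal_norm hp
    have hpos : 0 < p.norm.toReal := by rw [hr]; linarith
    refine lp.norm_le_of_forall_sum_le (f := (((a : 𝕜) • y + (b : 𝕜) • z : directSum 𝕜 E p) :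
      lp E p.norm)) hpos zero_le_one fun s => ?_
    have hys := lp.sum_rpow_le_norm_rpow hpos (y : lp E p.norm) s
    have hzs := lp.sum_rpow_le_norm_rpow hpos (z : lp E p.norm) s
    rw [hr] at hys hzs ⊢
    have hy1 : ‖(y : lp E p.norm)‖ ^ p.1 ≤ 1 := Real.rpow_le_one (norm_nonneg _) hy (by linarith)
    have hz1 : ‖(z : lp E p.norm)‖ ^ p.1 ≤ 1 := Real.rpow_le_one (norm_nonneg _) hz (by linarith)
    calc ∑ i ∈ s, ‖coord 𝕜 E p i ((a : 𝕜) • y + (b : 𝕜) • z)‖ ^ p.1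
        ≤ ∑ i ∈ s, (a ^ p.1 * ‖coord 𝕜 E p i y‖ ^ p.1 + b ^ p.1 * ‖coord 𝕜 E p i z‖ ^ p.1) := by
          refine Finset.sum_le_sum fun i _ => ?_
          by_cases hi : i ∈ R
          · rw [hc1 i hi, Real.mul_rpow ha (norm_nonneg _)]
            exact le_add_of_nonneg_right (by positivity)
          · rw [hc2 i hi, Real.mul_rpow hb (norm_nonneg _)]
            exact le_add_of_nonneg_left (by positivity)
      _ = a ^ p.1 * ∑ i ∈ s, ‖(y : lp E p.norm) i‖ ^ p.1 +
          b ^ p.1 * ∑ i ∈ s, ‖(z : lp E p.norm) i‖ ^ p.1 := by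
          rw [Finset.sum_add_distrib, Finset.mul_sum, Finset.mul_sum]
          rfl
      _ ≤ a ^ p.1 * 1 + b ^ p.1 * 1 := by
          gcongr
          · exact hys.trans hy1
          · exact hzs.trans hz1
      _ ≤ 1 ^ p.1 := by rw [Real.one_rpow, mul_one, mul_one]; exact h1 hp

/-- For `p > 1` the price `b ^ p` of adding a disjoint vector of size `b` is of smaller order than
the gain `b * τ`. With `b ^ (p - 1) ≤ τ / 2` and `a = 1 - b ^ p`, both `b ^ p` and `θ` are at most
half the gain. This fails for `p = 1`. -/
theorem exists_admissible (hp : p.1 = 0 ∨ 1 < p.1) {τ : ℝ} (hτ : 0 < τ) :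
    ∃ a b θ : ℝ, Admissible p a b ∧ 0 < b ∧ 0 < θ ∧ θ < 1 ∧ 1 ≤ a * (1 - θ) + b * τ := by
  rcases hp with hp | hp
  · refine ⟨1, 1, min τ (1 / 2), ⟨zero_le_one, zero_le_one, fun _ => ⟨le_rfl, le_rfl⟩,
      fun h => absurd hp h⟩, one_pos, by positivity, ?_, ?_⟩
    · exact (min_le_right _ _).trans_lt (by norm_num)
    · linarith [min_le_left τ (1 / 2)]
  · have hp1 : 0 < p.1 - 1 := by linarith
    obtain ⟨b, hb0, hb1, hb⟩ : ∃ b : ℝ, 0 < b ∧ b ≤ 1 ∧ b ^ (p.1 - 1) ≤ τ / 2 := by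
      refine ⟨min 1 ((τ / 2) ^ (p.1 - 1)⁻¹), by positivity, min_le_left _ _, ?_⟩
      calc (min 1 ((τ / 2) ^ (p.1 - 1)⁻¹)) ^ (p.1 - 1)
          ≤ ((τ / 2) ^ (p.1 - 1)⁻¹) ^ (p.1 - 1) := by
            gcongr
            exact min_le_right _ _
        _ = τ / 2 := by
            rw [← Real.rpow_mul (by positivity), inv_mul_cancel₀ hp1.ne', Real.rpow_one]
    have hbp : b ^ p.1 ≤ b * (τ / 2) := by
      have : b ^ p.1 = b * b ^ (p.1 - 1) := by
        rw [← Real.rpow_one_add' hb0.le (by linarith)]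
        ring_nf
      rw [this]
      gcongr
    have hbp1 : b ^ p.1 ≤ 1 := Real.rpow_le_one hb0.le hb1 (by linarith)
    have hbp0 : 0 ≤ b ^ p.1 := by positivity
    refine ⟨1 - b ^ p.1, b, min (b * (τ / 2)) (1 / 2), ⟨by linarith, hb0.le,
      fun h => by linarith, fun _ => ?_⟩, hb0, by positivity, ?_, ?_⟩
    · have : (1 - b ^ p.1) ^ p.1 ≤ 1 - b ^ p.1 :=
        Real.rpow_le_self_of_le_one (by linarith) (by linarith) hp.le
      linarith
    · exact (min_le_right _ _).trans_lt (by norm_num)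
    · have h1 := min_le_left (b * (τ / 2)) (1 / 2)
      have h2 : 0 ≤ min (b * (τ / 2)) (1 / 2) := by positivity
      nlinarith [mul_nonneg hbp0 h2]

/-- For `p ≠ 1`, a functional of norm at most one that almost attains its norm on finitely many
coordinates is small off these coordinates. -/
theorem exists_tail_small (hp : p.1 = 0 ∨ 1 < p.1) {τ : ℝ} (hτ : 0 < τ) :
    ∃ θ : ℝ, 0 < θ ∧ θ < 1 ∧ ∀ {ι : Type v} {E : ι → Type u} [∀ i, NormedAddCommGroup (E i)]
      [∀ i, NormedSpace 𝕜 (E i)] (φ : StrongDual 𝕜 (directSum 𝕜 E p)) (R : Finset ι),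
      ‖φ‖ ≤ 1 → 1 - θ < ‖φ.comp (trunc 𝕜 E p R)‖ → ‖φ - φ.comp (trunc 𝕜 E p R)‖ ≤ τ := by
  obtain ⟨a, b, θ, hab, hb, hθ, hθ1, h⟩ := exists_admissible hp hτ
  refine ⟨θ, hθ, hθ1, fun {ι E} _ _ φ R hφ hR => ?_⟩
  by_contra hlt
  obtain ⟨x, hx, hxτ⟩ := ContinuousLinearMap.exists_lt_apply_of_lt_opNorm _ (not_le.1 hlt)
  refine hxτ.not_ge ?_
  obtain ⟨y, hy, hyR⟩ := ContinuousLinearMap.exists_lt_apply_of_lt_opNorm _ hR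
  -- Unimodular factors make both values of `φ` nonnegative reals, so that they add up without
  -- cancellation.
  obtain ⟨c, hc, hcy⟩ := RCLike.exists_norm_eq_mul_self (φ (trunc 𝕜 E p R y))
  obtain ⟨d, hd, hdz⟩ := RCLike.exists_norm_eq_mul_self (φ (x - trunc 𝕜 E p R x))
  have hle : ‖(a : 𝕜) • (c • trunc 𝕜 E p R y) + (b : 𝕜) • (d • (x - trunc 𝕜 E p R x))‖ ≤ 1 := by
    refine norm_combine_le hab R ?_ ?_ ?_ ?_
    · rw [norm_smul, hc, one_mul]
      exact (norm_trunc_apply_le R y).trans hy.le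
    · rw [norm_smul, hd, one_mul]
      exact (norm_sub_trunc_apply_le R x).trans hx.le
    · intro i hi
      rw [map_smul, coord_trunc_of_notMem y hi, smul_zero]
    · intro i hi
      rw [map_smul, map_sub, coord_trunc_of_mem x hi, sub_self, smul_zero]
  have h2 := φ.le_of_opNorm_le_of_le hφ hle
  rw [map_add, map_smul, map_smul, map_smul, map_smul, smul_eq_mul, smul_eq_mul, smul_eq_mul,
    smul_eq_mul, ← hcy, ← hdz, ← RCLike.ofReal_mul, ← RCLike.ofReal_mul, ← RCLike.ofReal_add,
    RCLike.norm_ofReal] at h2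
  have h3 := (le_abs_self _).trans h2
  have h4 : a * (1 - θ) ≤ a * ‖φ (trunc 𝕜 E p R y)‖ :=
    mul_le_mul_of_nonneg_left hyR.le hab.1
  have h5 : b * ‖φ (x - trunc 𝕜 E p R x)‖ ≤ b * τ := by linarith
  have h6 := le_of_mul_le_mul_left h5 hb
  rwa [map_sub] at h6

/-- Test `φ` on the vector with coordinates `‖x_i‖ • v_i`, where `v_i` almost norms the `i`-th
coordinate of `φ`. It is dominated coordinatewise by `x`. This is Hölder's inequality without
identifying the dual of the sum. -/
theorem sum_norm_mul_norm_le {φ : StrongDual 𝕜 (directSum 𝕜 F p)} (hφ : ‖φ‖ ≤ 1)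
    (R : Finset ι) (x : directSum 𝕜 E p) :
    ∑ i ∈ R, ‖φ.comp (emb 𝕜 F p i)‖ * ‖coord 𝕜 E p i x‖ ≤ ‖x‖ := by
  have key : ∀ δ > 0, ∑ i ∈ R, ‖φ.comp (emb 𝕜 F p i)‖ * ‖coord 𝕜 E p i x‖ ≤
      ‖x‖ + δ * ∑ i ∈ R, ‖coord 𝕜 E p i x‖ := by
    intro δ hδ
    have hex : ∀ i, ∃ v : F i, ‖v‖ ≤ 1 ∧ ∃ t : ℝ, φ (emb 𝕜 F p i v) = (t : 𝕜) ∧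
        ‖φ.comp (emb 𝕜 F p i)‖ - δ ≤ t := by
      intro i
      obtain ⟨v, hv, hvt⟩ := ContinuousLinearMap.exists_lt_apply_of_lt_opNorm
        (φ.comp (emb 𝕜 F p i)) (sub_lt_self _ hδ)
      obtain ⟨c, hc, hcv⟩ := RCLike.exists_norm_eq_mul_self (φ (emb 𝕜 F p i v))
      refine ⟨c • v, by rw [norm_smul, hc, one_mul]; exact hv.le, _, ?_, hvt.le⟩
      rw [map_smul, map_smul, smul_eq_mul, ← hcv]
      rfl
    choose v hv t ht hvt using hex
    set y : directSum 𝕜 F p := ∑ i ∈ R, emb 𝕜 F p i ((‖coord 𝕜 E p i x‖ : 𝕜) • v i) with hy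
    have hyx : ‖y‖ ≤ ‖x‖ := by
      refine norm_le_norm_of_coord fun i => ?_
      by_cases hi : i ∈ R
      · rw [hy, coord_sum_emb_of_mem (fun i => (‖coord 𝕜 E p i x‖ : 𝕜) • v i) hi, norm_smul,
          RCLike.norm_ofReal, abs_norm]
        exact mul_le_of_le_one_right (norm_nonneg _) (hv i)
      · rw [hy, coord_sum_emb_of_notMem (fun i => (‖coord 𝕜 E p i x‖ : 𝕜) • v i) hi, norm_zero]
        exact norm_nonneg _
    have hφy : φ y = ((∑ i ∈ R, ‖coord 𝕜 E p i x‖ * t i : ℝ) : 𝕜) := by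
      rw [hy, map_sum, RCLike.ofReal_sum]
      refine Finset.sum_congr rfl fun i _ => ?_
      rw [map_smul, map_smul, ht, smul_eq_mul, RCLike.ofReal_mul]
    have h1 : ∑ i ∈ R, ‖coord 𝕜 E p i x‖ * t i ≤ ‖x‖ := by
      have := φ.le_of_opNorm_le hφ y
      rw [hφy, RCLike.norm_ofReal, one_mul] at this
      exact (le_abs_self _).trans (this.trans hyx)
    refine le_trans ?_ (add_le_add_left h1 _)
    rw [Finset.mul_sum, ← Finset.sum_add_distrib]
    refine Finset.sum_le_sum fun i _ => ?_
    nlinarith [hvt i, norm_nonneg (coord 𝕜 E p i x)]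
  set A := ∑ i ∈ R, ‖coord 𝕜 E p i x‖
  have hA : 0 ≤ A := Finset.sum_nonneg fun i _ => norm_nonneg _
  refine le_of_forall_pos_le_add fun δ hδ => ?_
  refine (key (δ / (A + 1)) (by positivity)).trans ?_
  gcongr
  rw [div_mul_eq_mul_div, div_le_iff₀ (by positivity)]
  nlinarith

variable {C : ℝ≥0} {T : ∀ i, E i →L[𝕜] F i} {hT : ∀ i, ‖T i‖ ≤ C}

theorem coord_directSumMap (i : ι) (x : directSum 𝕜 E p) :
    coord 𝕜 F p i (directSumMap p C T hT x) = T i (coord 𝕜 E p i x) := rfl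

theorem directSumMap_emb (i : ι) (a : E i) :
    directSumMap p C T hT (emb 𝕜 E p i a) = emb 𝕜 F p i (T i a) := by
  refine ext_coord fun j => ?_
  rw [coord_directSumMap]
  by_cases h : j = i
  · subst h
    rw [coord_emb_same, coord_emb_same]
  · rw [coord_emb_ne h, coord_emb_ne h, map_zero]

theorem directSumMap_trunc (R : Finset ι) (x : directSum 𝕜 E p) :
    directSumMap p C T hT (trunc 𝕜 E p R x) = trunc 𝕜 F p R (directSumMap p C T hT x) := by
  rw [trunc_apply, trunc_apply, map_sum]
  exact Finset.sum_congr rfl fun i _ => by rw [directSumMap_emb, coord_directSumMap]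

theorem comp_emb_mem {x : StrongDual 𝕜 (directSum 𝕜 E p)}
    (hx : x ∈ dualBallImage (directSumMap p C T hT)) (i : ι) :
    x.comp (emb 𝕜 E p i) ∈ dualBallImage (T i) := by
  obtain ⟨φ, hφ, rfl⟩ := mem_dualBallImage.1 hx
  refine mem_dualBallImage.2 ⟨φ.comp (emb 𝕜 F p i), ?_, ?_⟩
  · refine ContinuousLinearMap.opNorm_le_bound _ zero_le_one fun v => ?_
    have := φ.le_of_opNorm_le hφ (emb 𝕜 F p i v)
    rwa [norm_emb] at this
  · ext v
    simp [directSumMap_emb]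

theorem comp_coord_mem {i : ι} {f : StrongDual 𝕜 (E i)} (hf : f ∈ dualBallImage (T i)) :
    f.comp (coord 𝕜 E p i) ∈ dualBallImage (directSumMap p C T hT) := by
  obtain ⟨φ, hφ, rfl⟩ := mem_dualBallImage.1 hf
  refine mem_dualBallImage.2 ⟨φ.comp (coord 𝕜 F p i), ?_, rfl⟩
  refine ContinuousLinearMap.opNorm_le_bound _ zero_le_one fun v => ?_
  exact (φ.le_of_opNorm_le hφ _).trans (by gcongr; exact norm_coord_le i v)

theorem norm_le_norm_comp_coord {i : ι} (f : StrongDual 𝕜 (E i)) :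
    ‖f‖ ≤ ‖f.comp (coord 𝕜 E p i)‖ := by
  refine ContinuousLinearMap.opNorm_le_bound _ (norm_nonneg (f.comp (coord 𝕜 E p i))) fun v => ?_
  have := (f.comp (coord 𝕜 E p i)).le_opNorm (emb 𝕜 E p i v)
  rwa [norm_emb, ContinuousLinearMap.comp_apply, coord_emb_same] at this

/-- Composition with the `i`-th coordinate projection is weak-star continuous, does not shrink
distances, and maps the set of the summand into that of the sum. -/
theorem iterDeriv_directSumMap_nonempty {ε : ℝ} (hε : 0 ≤ ε) {α : Ordinal} (i : ι)
    {E : ι → Type (max u v)} [∀ i, NormedAddCommGroup (E i)] [∀ i, NormedSpace 𝕜 (E i)]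
    {F : ι → Type (max u v)} [∀ i, NormedAddCommGroup (F i)] [∀ i, NormedSpace 𝕜 (F i)]
    {T : ∀ i, E i →L[𝕜] F i} {hT : ∀ i, ‖T i‖ ≤ C}
    (h : (iterDeriv ε (dualBallImage (T i)) α).Nonempty) :
    (iterDeriv ε (dualBallImage (directSumMap p C T hT)) α).Nonempty := by
  obtain ⟨x, hx⟩ := h
  have := map_mem_iterDeriv hε one_pos (fun f : StrongDual 𝕜 (E i) => f.comp (coord 𝕜 E p i))
    (continuous_weakDual_comp _) (fun x y => ?_)
    (fun f hf => comp_coord_mem (p := p) (hT := hT) hf) α x hx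
  · rw [one_mul] at this
    exact ⟨_, this⟩
  · rw [one_mul, ← ContinuousLinearMap.sub_comp]
    exact norm_le_norm_comp_coord _

end Coordinates

end SzlenkOp

namespace SzlenkOp

open Order StrongDual WeakDual

/-! ### Lower bounds: finite `ℓ_1`-sums -/

section Products

variable {𝕜 : Type*} [RCLike 𝕜] {ι : Type v} [Fintype ι] {C : ℝ≥0}
  {E : ι → Type (max u v)} [∀ i, NormedAddCommGroup (E i)] [∀ i, NormedSpace 𝕜 (E i)]
  {F : ι → Type (max u v)} [∀ i, NormedAddCommGroup (F i)] [∀ i, NormedSpace 𝕜 (F i)]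
  {T : ∀ i, E i →L[𝕜] F i} {hT : ∀ i, ‖T i‖ ≤ C}

theorem sum_norm_coord_le (x : directSum 𝕜 F BanachOp.one) :
    ∑ i, ‖coord 𝕜 F BanachOp.one i x‖ ≤ ‖x‖ := by
  have h1 : BanachOp.one.norm.toReal = 1 := SumExponent.toReal_norm one_ne_zero
  have := lp.sum_rpow_le_norm_rpow (by rw [h1]; exact one_pos) (x : lp F BanachOp.one.norm)
    Finset.univ
  simp only [h1, Real.rpow_one] at this
  exact this

theorem sum_comp_coord_mem {f : ∀ i, StrongDual 𝕜 (E i)} (hf : ∀ i, f i ∈ dualBallImage (T i)) :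
    ∑ i, (f i).comp (coord 𝕜 E BanachOp.one i) ∈
      dualBallImage (directSumMap BanachOp.one C T hT) := by
  choose φ hφ hφf using fun i => mem_dualBallImage.1 (hf i)
  refine mem_dualBallImage.2 ⟨∑ i, (φ i).comp (coord 𝕜 F BanachOp.one i), ?_, ?_⟩
  · refine ContinuousLinearMap.opNorm_le_bound _ zero_le_one fun x => ?_
    rw [one_mul, sum_apply]
    refine (norm_sum_le _ _).trans ((Finset.sum_le_sum fun i _ => ?_).trans (sum_norm_coord_le x))
    exact ((φ i).le_of_opNorm_le (hφ i) _).trans (one_mul _).le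
  · ext x
    simp only [ContinuousLinearMap.comp_apply, sum_apply, ← hφf,
      coord_directSumMap]

/-- With the other coordinates frozen, inserting a functional into coordinate `i` is an expanding
affine map. By induction its image of the whole set of `T i` already lies in the iterate for `R`, so
coordinate `i` contributes another `lam` derivations. -/
theorem sum_comp_coord_mem_iterDeriv {ε : ℝ} (hε : 0 ≤ ε) (lam : Ordinal) (R : Finset ι) :
    ∀ f : ∀ i, StrongDual 𝕜 (E i), (∀ i, f i ∈ dualBallImage (T i)) →
      (∀ i ∈ R, f i ∈ iterDeriv ε (dualBallImage (T i)) lam) →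
      ∑ i, (f i).comp (coord 𝕜 E BanachOp.one i) ∈
        iterDeriv ε (dualBallImage (directSumMap BanachOp.one C T hT)) (lam * R.card) := by
  classical
  induction R using Finset.induction_on with
  | empty =>
    intro f hf _
    simpa using sum_comp_coord_mem hf
  | insert i R hi ih =>
    intro f hf hR
    rw [Finset.card_insert_of_notMem hi]
    push_cast
    rw [mul_add_one, iterDeriv_add]
    let c := ∑ j ∈ Finset.univ.erase i, (f j).comp (coord 𝕜 E BanachOp.one j)
    have hsum : ∀ h : StrongDual 𝕜 (E i),
        ∑ j, (Function.update f i h j).comp (coord 𝕜 E BanachOp.one j) =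
          h.comp (coord 𝕜 E BanachOp.one i) + c := by
      intro h
      rw [← Finset.add_sum_erase _ _ (Finset.mem_univ i), Function.update_self]
      congr 1
      refine Finset.sum_congr rfl fun j hj => ?_
      rw [Function.update_of_ne (Finset.ne_of_mem_erase hj)]
    have key := map_mem_iterDeriv hε one_pos
      (fun h : StrongDual 𝕜 (E i) => h.comp (coord 𝕜 E BanachOp.one i) + c)
      (WeakDual.continuous_of_continuous_eval fun x =>
        (WeakDual.eval_continuous _).add continuous_const)
      (fun x y => ?_) (A := dualBallImage (T i))
      (B := iterDeriv ε (dualBallImage (directSumMap BanachOp.one C T hT)) (lam * R.card))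
      (fun h hh => ?_) lam (f i) (hR i (Finset.mem_insert_self i R))
    · rw [one_mul] at key
      convert key using 1
      rw [← hsum, Function.update_eq_self]
    · rw [one_mul, add_sub_add_right_eq_sub, ← ContinuousLinearMap.sub_comp]
      exact norm_le_norm_comp_coord _
    · change h.comp (coord 𝕜 E BanachOp.one i) + c ∈ _
      rw [← hsum]
      refine ih _ (fun j => ?_) fun j hj => ?_
      · by_cases hji : j = i
        · subst hji
          rwa [Function.update_self]
        · rw [Function.update_of_ne hji]
          exact hf j
      · rw [Function.update_of_ne (fun hji => hi (by rwa [← hji]))]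
        exact hR j (Finset.mem_insert_of_mem hj)

end Products

/-! ### Lower bounds for the transfinite construction -/

section Iterates

variable {𝕜 : Type*} [RCLike 𝕜] {C : ℝ≥0}

namespace BanachOp

theorem iter_zero (r : SumExponent) (T : BanachOp.{u} 𝕜 C) : T.iter r 0 = T :=
  Ordinal.limitRecOn_zero _ _ _

theorem iter_add_one (r : SumExponent) (T : BanachOp.{u} 𝕜 C) (α : Ordinal.{u}) :
    T.iter r (α + 1) = (T.iter r α).plus r :=
  Ordinal.limitRecOn_add_one _ _ _ _

theorem iter_limit (r : SumExponent) (T : BanachOp.{u} 𝕜 C) {α : Ordinal.{u}}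
    (hα : IsSuccLimit α) :
    T.iter r α = sum r (fun i : α.ToType => T.iter r i.toOrd.1) :=
  Ordinal.limitRecOn_limit _ _ _ _ hα

/-- The iterated derivation of the image of the dual ball under a bundled operator. -/
def derived (S : BanachOp.{u} 𝕜 C) (ε : ℝ) (α : Ordinal.{u}) : Set (StrongDual 𝕜 S.Dom) :=
  iterDeriv ε (dualBallImage S.op) α

theorem derived_limit_nonempty {S : BanachOp.{u} 𝕜 C} {ε : ℝ} (hε : 0 ≤ ε) {α : Ordinal.{u}}
    (hα : IsSuccLimit α) (h : ∀ β < α, (S.derived ε β).Nonempty) : (S.derived ε α).Nonempty :=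
  iterDeriv_limit_nonempty hε (isCompact_dualBallImage S.op) hα h

theorem derived_anti {S : BanachOp.{u} 𝕜 C} {ε : ℝ} {α β : Ordinal.{u}} (h : α ≤ β)
    (hβ : (S.derived ε β).Nonempty) : (S.derived ε α).Nonempty :=
  hβ.mono (iterDeriv_antitone ε _ h)

theorem derived_copies_nonempty {S : BanachOp.{u} 𝕜 C} {ε : ℝ} (hε : 0 ≤ ε) {α : Ordinal.{u}}
    (h : (S.derived ε α).Nonempty) (n : ℕ) : ((S.copies n).derived ε (α * n)).Nonempty := by
  obtain ⟨x, hx⟩ := h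
  have hx0 : x ∈ dualBallImage S.op := by
    simpa using iterDeriv_antitone ε _ (zero_le (a := α)) hx
  have := sum_comp_coord_mem_iterDeriv.{u, 0} (ι := Fin n) (E := fun _ => S.Dom)
    (F := fun _ => S.Cod) (T := fun _ => S.op) (hT := fun _ => S.norm_op_le) hε α Finset.univ
    (fun _ => x) (fun _ => hx0) (fun _ _ => hx)
  rw [Finset.card_univ, Fintype.card_fin] at this
  exact ⟨_, this⟩

theorem derived_sum_nonempty {ι : Type v} (r : SumExponent) {S : ι → BanachOp.{max u v} 𝕜 C}
    {ε : ℝ} (hε : 0 ≤ ε) {α : Ordinal} (i : ι) (h : ((S i).derived ε α).Nonempty) :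
    ((sum r S).derived ε α).Nonempty :=
  iterDeriv_directSumMap_nonempty.{u, v} (p := r) (hT := fun i => (S i).norm_op_le) hε i h

theorem derived_plus_nonempty {S : BanachOp.{u} 𝕜 C} (r : SumExponent) {ε : ℝ} (hε : 0 ≤ ε)
    {α : Ordinal.{u}} (h : (S.derived ε (ω ^ α)).Nonempty) :
    ((S.plus r).derived ε (ω ^ (α + 1))).Nonempty := by
  refine derived_limit_nonempty hε
    (Ordinal.isSuccLimit_opow_left Ordinal.isSuccLimit_omega0 (by simp)) fun β hβ => ?_
  obtain ⟨n, hn⟩ := Ordinal.lt_omega0_opow_succ.1 (by simpa using hβ)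
  -- The summand with index `n` is `S_[n + 1]`, which survives `ω ^ α * (n + 1)` derivations, more
  -- than the `ω ^ α * n` needed.
  refine derived_sum_nonempty.{u, 0} r hε n
    (derived_anti (hn.le.trans ?_) (derived_copies_nonempty hε h (n + 1)))
  gcongr
  simp

theorem derived_iter_nonempty (T : BanachOp.{u} 𝕜 C) (r : SumExponent) {ε : ℝ} (hε : 0 ≤ ε)
    {η : Ordinal.{u}} (h : (T.derived ε (ω ^ η)).Nonempty) (α : Ordinal.{u}) :
    ((T.iter r α).derived ε (ω ^ (η + α))).Nonempty := by
  induction α using Ordinal.limitRecOn with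
  | zero => rwa [iter_zero, add_zero]
  | add_one α ih =>
    rw [iter_add_one, ← add_assoc]
    exact derived_plus_nonempty r hε ih
  | limit α hα ih =>
    have hl : IsSuccLimit (η + α) := Ordinal.isSuccLimit_add η hα
    refine derived_limit_nonempty hε
      (Ordinal.isSuccLimit_opow Ordinal.one_lt_omega0 hl) fun β hβ => ?_
    rw [Ordinal.lt_opow_of_isSuccLimit Ordinal.omega0_ne_zero hl] at hβ
    obtain ⟨δ, hδ, hβ⟩ := hβ
    obtain ⟨ξ, hξ, hδξ⟩ := (Ordinal.lt_add_iff hα.ne_bot).1 hδ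
    rw [iter_limit r T hα]
    refine derived_sum_nonempty.{u, u} r hε (Ordinal.ToType.mk ⟨ξ, hξ⟩)
      (derived_anti (β := ω ^ (η + ξ)) ?_ ?_)
    · exact hβ.le.trans (Ordinal.opow_le_opow_right Ordinal.omega0_pos hδξ)
    · rw [show ((Ordinal.ToType.mk ⟨ξ, hξ⟩).toOrd : Ordinal) = ξ from
        congrArg Subtype.val (Ordinal.ToType.mk.symm_apply_apply _)]
      exact ih ξ hξ

end BanachOp

end Iterates

end SzlenkOp

namespace SzlenkOp

open Order StrongDual WeakDual

/-! ### Derivation ranks weighted by size -/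

section Rank

variable {𝕜 : Type*} [RCLike 𝕜]
  {E : Type u} [NormedAddCommGroup E] [NormedSpace 𝕜 E]
  {F : Type u} [NormedAddCommGroup F] [NormedSpace 𝕜 F]

theorem exists_rank {ε : ℝ} {K : Set (StrongDual 𝕜 E)} {lam : Ordinal.{u}}
    (h : iterDeriv ε K lam = ∅) :
    ∃ ρ : StrongDual 𝕜 E → Ordinal.{u}, ∀ x ∈ K,
      ρ x < lam ∧ x ∈ iterDeriv ε K (ρ x) ∧ x ∉ iterDeriv ε K (ρ x + 1) := by
  -- The rank is the last iterate containing `x`. It exists because limit iterates are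
  -- intersections.
  refine ⟨fun x => sInf {α | x ∉ iterDeriv ε K (α + 1)}, fun x hx => ?_⟩
  set S : Set Ordinal.{u} := {α | x ∉ iterDeriv ε K (α + 1)}
  have hne : S.Nonempty := by
    refine ⟨lam, fun hmem => ?_⟩
    have := iterDeriv_antitone ε K (le_self_add (a := lam) (b := 1)) hmem
    rw [h] at this
    exact this
  have h1 : x ∉ iterDeriv ε K (sInf S + 1) := csInf_mem hne
  have hlt : ∀ β < sInf S, x ∈ iterDeriv ε K (β + 1) := fun β hβ => by
    by_contra hb
    exact notMem_of_lt_csInf' hβ hb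
  have h2 : x ∈ iterDeriv ε K (sInf S) := by
    generalize sInf S = α at hlt
    induction α using Ordinal.limitRecOn with
    | zero => simpa using hx
    | add_one β _ => exact hlt β (lt_add_one β)
    | limit β hβ _ =>
      rw [iterDeriv_limit _ _ hβ]
      simp only [Set.mem_iInter]
      exact fun i hi => iterDeriv_antitone ε K le_self_add (hlt i hi)
  refine ⟨?_, h2, h1⟩
  by_contra hge
  have := iterDeriv_antitone ε K (not_lt.1 hge) h2
  rw [h] at this
  exact this

theorem continuous_weakDual_smul (c : 𝕜) :
    Continuous fun w : WeakDual 𝕜 E => toWeakDual (c • toStrongDual w) :=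
  WeakDual.continuous_of_continuous_eval fun x => (WeakDual.eval_continuous x).const_smul c

theorem norm_inv_smul {t : ℝ} (ht : 0 < t) (f : StrongDual 𝕜 E) :
    ‖((t : 𝕜)⁻¹) • f‖ = t⁻¹ * ‖f‖ := by
  rw [norm_smul, norm_inv, RCLike.norm_ofReal, abs_of_pos ht]

theorem norm_inv_smul_sub {t : ℝ} (ht : 0 < t) (f g : StrongDual 𝕜 E) :
    ‖((t : 𝕜)⁻¹) • f - ((t : 𝕜)⁻¹) • g‖ = t⁻¹ * ‖f - g‖ := by
  rw [← smul_sub ((t : 𝕜)⁻¹) f g, norm_inv_smul ht]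

theorem norm_sub_le_of_approx (f g f' g' : StrongDual 𝕜 E) :
    ‖f - g‖ ≤ ‖f' - g'‖ + (‖f - f'‖ + ‖g - g'‖) :=
  calc ‖f - g‖ = ‖(f' - g') + ((f - f') - (g - g'))‖ := by congr 1; abel
    _ ≤ ‖f' - g'‖ + ‖(f - f') - (g - g')‖ := norm_add_le _ _
    _ ≤ ‖f' - g'‖ + (‖f - f'‖ + ‖g - g'‖) := by gcongr; exact norm_sub_le _ _

theorem smul_mem_of_le {T : E →L[𝕜] F} {x : StrongDual 𝕜 E} {s t : ℝ} (hs : 0 < s) (hst : s ≤ t)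
    (h : ((s : 𝕜)⁻¹) • x ∈ dualBallImage T) : ((t : 𝕜)⁻¹) • x ∈ dualBallImage T := by
  have ht : 0 < t := hs.trans_le hst
  have := smul_mem_dualBallImage h (c := ((s / t : ℝ) : 𝕜)) (by
    rw [RCLike.norm_ofReal, abs_of_pos (by positivity)]
    exact div_le_one_of_le₀ hst ht.le)
  rw [smul_smul] at this
  convert this using 2
  have : (s : 𝕜) ≠ 0 := RCLike.ofReal_ne_zero.2 hs.ne'
  push_cast
  field_simp

theorem smul_mem_of_norm_le {T : E →L[𝕜] F} {ψ : StrongDual 𝕜 F} {t : ℝ} (ht : 0 < t)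
    (h : ‖ψ‖ ≤ t) : ((t : 𝕜)⁻¹) • ψ.comp T ∈ dualBallImage T := by
  refine mem_dualBallImage.2 ⟨((t : 𝕜)⁻¹) • ψ, ?_, by ext; simp⟩
  rwa [norm_inv_smul ht, inv_mul_le_iff₀ ht, mul_one]

/-- A rank on `T*(B_{F*})` that combines the derivation rank with the size of a functional
measured in multiples of `κ`. -/
theorem exists_scaled_rank (T : E →L[𝕜] F) {ε κ : ℝ} (hε : 0 ≤ ε) (hκ : 0 < κ) {β : Ordinal.{u}}
    (h : iterDeriv ε (dualBallImage T) (ω ^ β) = ∅) :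
    ∃ (φ : StrongDual 𝕜 E → Ordinal.{u}) (c : StrongDual 𝕜 E → ℝ), ∀ x ∈ dualBallImage T,
      φ x < ω ^ (β + 1) ∧ 0 ≤ c x ∧ (∀ ψ : StrongDual 𝕜 F, ψ.comp T = x → c x ≤ ‖ψ‖ + κ) ∧
      ∃ V : Set (WeakDual 𝕜 E), IsOpen V ∧ toWeakDual x ∈ V ∧
        (∀ y ∈ dualBallImage T, toWeakDual y ∈ V → φ y ≤ φ x) ∧
        ∀ y ∈ dualBallImage T, ∀ z ∈ dualBallImage T, toWeakDual y ∈ V → toWeakDual z ∈ V →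
          φ y = φ x → φ z = φ x → ‖y - z‖ ≤ ε * c x := by
  classical
  set K := dualBallImage T with hKdef
  have hcl := isClosed_iterDeriv hε (isCompact_dualBallImage T).isClosed
  obtain ⟨ρ, hρ⟩ := exists_rank h
  -- Sizes are rounded to the grid `κ, 2κ, …`. The index `j x` below is the first with `x ∈ t (j x)
  -- • K`, and `j x ≤ N` on `K`.
  set t : ℕ → ℝ := fun j => (j + 1) * κ with ht
  have htpos : ∀ j, 0 < t j := fun j => by positivity
  obtain ⟨N, hN⟩ : ∃ N : ℕ, 1 ≤ t N := by
    obtain ⟨N, hN⟩ := exists_nat_ge (1 / κ)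
    refine ⟨N, ?_⟩
    rw [div_le_iff₀ hκ] at hN
    simp only [ht]
    linarith
  have hQN : ∀ x ∈ K, ((t N : 𝕜)⁻¹) • x ∈ K := fun x hx =>
    smul_mem_of_le one_pos hN (by simpa using hx)
  set j : StrongDual 𝕜 E → ℕ := fun x => sInf {i | ((t i : 𝕜)⁻¹) • x ∈ K} with hj
  have hjmem : ∀ x ∈ K, ((t (j x) : 𝕜)⁻¹) • x ∈ K := fun x hx =>
    Nat.sInf_mem (s := {i | ((t i : 𝕜)⁻¹) • x ∈ K}) ⟨N, hQN x hx⟩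
  have hjlt : ∀ x i, i < j x → ((t i : 𝕜)⁻¹) • x ∉ K := fun x i hi hmem =>
    Nat.notMem_of_lt_sInf hi hmem
  have hjle : ∀ x i, ((t i : 𝕜)⁻¹) • x ∈ K → j x ≤ i := fun x i hi => Nat.sInf_le hi
  have hjN : ∀ x ∈ K, j x ≤ N := fun x hx => hjle x N (hQN x hx)
  set w : StrongDual 𝕜 E → StrongDual 𝕜 E := fun x => ((t (j x) : 𝕜)⁻¹) • x with hw
  have hP : (0 : Ordinal.{u}) < ω ^ β := Ordinal.opow_pos _ Ordinal.omega0_pos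
  -- Size comes first and larger size means smaller rank: the sets `t i • K` are weak-star closed,
  -- so size cannot drop near `x`. Among equal sizes the derivation rank of the rescaled functional
  -- decides, and undoing the scaling turns diameter `ε` into `ε * t (j x)`.
  refine ⟨fun x => ω ^ β * (N - j x : ℕ) + ρ (w x), fun x => t (j x), fun x hx => ⟨?_, ?_, ?_, ?_⟩⟩
  · have h1 := mul_add_lt_mul_add (d := 0) (hρ _ (hjmem x hx)).1 (Nat.lt_succ_self (N - j x))
    refine h1.trans ?_
    rw [add_zero, Ordinal.opow_add, Ordinal.opow_one]
    gcongr
    exact Ordinal.natCast_lt_omega0 _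
  · exact (htpos _).le
  · rintro ψ rfl
    change t (j (ψ.comp T)) ≤ ‖ψ‖ + κ
    rcases Nat.eq_zero_or_pos (j (ψ.comp T)) with h0 | h0
    · rw [h0]
      simp only [ht]
      have := norm_nonneg ψ
      rw [Nat.cast_zero]
      linarith
    · have h1 : t (j (ψ.comp T) - 1) < ‖ψ‖ := by
        by_contra hle
        exact hjlt _ _ (Nat.sub_lt h0 one_pos) (smul_mem_of_norm_le (htpos _) (not_lt.1 hle))
      have h2 : t (j (ψ.comp T)) = t (j (ψ.comp T) - 1) + κ := by
        simp only [ht]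
        rw [Nat.cast_sub h0]
        push_cast
        ring
      linarith
  · obtain ⟨h1, h2, h3⟩ := hρ _ (hjmem x hx)
    have h3' := h3
    rw [iterDeriv_add_one] at h3'
    obtain ⟨V, hV, hxV, hVd⟩ := notMem_szDeriv hε h3' h2
    have hsm := continuous_weakDual_smul (E := E) ((t (j x) : 𝕜)⁻¹)
    -- On `V1` the size does not drop; on `V2` the derivation rank at equal size does not grow; `V3`
    -- controls the diameter.
    let V1 : Set (WeakDual 𝕜 E) := ⋂ i ∈ Set.Iio (j x),
      {y | ((t i : 𝕜)⁻¹) • toStrongDual y ∉ K}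
    let V2 : Set (WeakDual 𝕜 E) :=
      {y | ((t (j x) : 𝕜)⁻¹) • toStrongDual y ∉ iterDeriv ε K (ρ (w x) + 1)}
    let V3 : Set (WeakDual 𝕜 E) := {y | toWeakDual (((t (j x) : 𝕜)⁻¹) • toStrongDual y) ∈ V}
    have hV1 : IsOpen V1 := (Set.finite_Iio (j x)).isOpen_biInter fun i _ =>
      ((isCompact_dualBallImage T).isClosed.isOpen_compl).preimage
        (continuous_weakDual_smul ((t i : 𝕜)⁻¹))
    have hV2 : IsOpen V2 := (hcl (ρ (w x) + 1)).isOpen_compl.preimage hsm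
    have hV3 : IsOpen V3 := hV.preimage hsm
    have hcase : ∀ y ∈ K, toWeakDual y ∈ V1 ∩ V2 ∩ V3 →
        (j x < j y ∧ ω ^ β * (N - j y : ℕ) + ρ (w y) < ω ^ β * (N - j x : ℕ) + ρ (w x)) ∨
        (j y = j x ∧ ρ (w y) ≤ ρ (w x)) := by
      intro y hy hyV
      have hle : j x ≤ j y := by
        by_contra hlt
        have := Set.mem_iInter₂.1 hyV.1.1 (j y) (not_le.1 hlt)
        exact this (hjmem y hy)
      rcases hle.eq_or_lt with heq | hlt
      · right
        refine ⟨heq.symm, ?_⟩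
        by_contra hlt
        have hy2 : w y ∉ iterDeriv ε K (ρ (w x) + 1) := by
          have := hyV.1.2
          simp only [hw, ← heq]
          exact this
        exact hy2 (iterDeriv_antitone ε K (add_one_le_of_lt (not_le.1 hlt))
          (hρ _ (hjmem y hy)).2.1)
      · left
        refine ⟨hlt, mul_add_lt_mul_add (hρ _ (hjmem y hy)).1 ?_⟩
        have := hjN y hy
        lia
    have heq : ∀ y ∈ K, toWeakDual y ∈ V1 ∩ V2 ∩ V3 →
        ω ^ β * (N - j y : ℕ) + ρ (w y) = ω ^ β * (N - j x : ℕ) + ρ (w x) →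
        ((t (j x) : 𝕜)⁻¹) • y ∈ iterDeriv ε K (ρ (w x)) := by
      intro y hy hyV hyx
      rcases hcase y hy hyV with h | ⟨h, h'⟩
      · exact absurd hyx h.2.ne
      · rw [h] at hyx
        have h4 : ρ (w y) = ρ (w x) := add_left_cancel hyx
        have h5 := (hρ _ (hjmem y hy)).2.1
        rw [← h4, ← h]
        exact h5
    refine ⟨V1 ∩ V2 ∩ V3, (hV1.inter hV2).inter hV3, ⟨⟨?_, h3⟩, hxV⟩, ?_, ?_⟩
    · exact Set.mem_iInter₂.2 fun i hi => hjlt x i hi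
    · intro y hy hyV
      rcases hcase y hy hyV with h | ⟨h, h'⟩
      · exact h.2.le
      · simp only [h]
        gcongr
    · intro y hy z hz hyV hzV hyx hzx
      have := hVd _ (heq y hy hyV hyx) _ (heq z hz hzV hzx) hyV.2 hzV.2
      rw [norm_inv_smul_sub (htpos _), inv_mul_le_iff₀ (htpos _)] at this
      linarith

end Rank

/-! ### Upper bounds for direct sums -/

section UpperBound

variable {𝕜 : Type*} [RCLike 𝕜] {ι : Type v} {C : ℝ≥0} {p : SumExponent}
  {E : ι → Type (max u v)} [∀ i, NormedAddCommGroup (E i)] [∀ i, NormedSpace 𝕜 (E i)]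
  {F : ι → Type (max u v)} [∀ i, NormedAddCommGroup (F i)] [∀ i, NormedSpace 𝕜 (F i)]
  {T : ∀ i, E i →L[𝕜] F i} {hT : ∀ i, ‖T i‖ ≤ C}

/-- Bare coordinate bounds `ε` would add up over `R`. Weighted by the coordinate norms of a single
functional in the unit ball, they combine to `ε` by `sum_norm_mul_norm_le`, up to the rounding error
`κ`. This is why the rank records size. -/
theorem norm_comp_trunc_le {f : StrongDual 𝕜 (directSum 𝕜 E p)} {R : Finset ι} {c : ι → ℝ}
    {ε κ : ℝ} (hε : 0 ≤ ε) (hκ : 0 ≤ κ) {φ : StrongDual 𝕜 (directSum 𝕜 F p)} (hφ : ‖φ‖ ≤ 1)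
    (hc : ∀ i ∈ R, c i ≤ ‖φ.comp (emb 𝕜 F p i)‖ + κ)
    (hf : ∀ i ∈ R, ‖f.comp (emb 𝕜 E p i)‖ ≤ ε * c i) :
    ‖f.comp (trunc 𝕜 E p R)‖ ≤ ε * (1 + κ * R.card) := by
  refine ContinuousLinearMap.opNorm_le_bound _ (by positivity) fun x => ?_
  rw [ContinuousLinearMap.comp_apply, trunc_apply, map_sum]
  have h1 := sum_norm_mul_norm_le hφ R x
  have h2 : ∑ i ∈ R, ‖coord 𝕜 E p i x‖ ≤ R.card * ‖x‖ := by
    refine (Finset.sum_le_card_nsmul _ _ _ fun i _ => norm_coord_le i x).trans ?_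
    rw [nsmul_eq_mul]
  calc ‖∑ i ∈ R, f (emb 𝕜 E p i (coord 𝕜 E p i x))‖
      ≤ ∑ i ∈ R, ε * (‖φ.comp (emb 𝕜 F p i)‖ * ‖coord 𝕜 E p i x‖ + κ * ‖coord 𝕜 E p i x‖) := by
        refine (norm_sum_le _ _).trans (Finset.sum_le_sum fun i hi => ?_)
        refine ((f.comp (emb 𝕜 E p i)).le_of_opNorm_le (hf i hi) _).trans ?_
        rw [← add_mul, mul_assoc]
        gcongr
        exact hc i hi
    _ = ε * (∑ i ∈ R, ‖φ.comp (emb 𝕜 F p i)‖ * ‖coord 𝕜 E p i x‖ +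
          κ * ∑ i ∈ R, ‖coord 𝕜 E p i x‖) := by
        rw [← Finset.mul_sum, Finset.sum_add_distrib, Finset.mul_sum R _ κ]
    _ ≤ ε * (‖x‖ + κ * (R.card * ‖x‖)) := by gcongr
    _ = ε * (1 + κ * R.card) * ‖x‖ := by ring

/-- On an open set where the tails off a finite set of coordinates are small, the derivation of a
direct sum stops, up to a factor `ω`, as soon as those of its summands. -/
theorem notMem_of_tail_small {ε ε' τ : ℝ} (hε : 0 ≤ ε) (hτ : 0 ≤ τ) (hlt : ε + 2 * τ < ε')
    {β : Ordinal} (h : ∀ i, iterDeriv ε (dualBallImage (T i)) (ω ^ β) = ∅) (R : Finset ι)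
    {W : Set (WeakDual 𝕜 (directSum 𝕜 E p))} (hW : IsOpen W)
    (htail : ∀ f ∈ dualBallImage (directSumMap p C T hT), toWeakDual f ∈ W →
      ‖f - f.comp (trunc 𝕜 E p R)‖ ≤ τ) :
    ∀ f ∈ iterDeriv ε' (dualBallImage (directSumMap p C T hT)) (ω ^ (β + 1)),
      toWeakDual f ∉ W := by
  -- The grid is chosen so fine that the rounding errors of all coordinates in `R` fit into the gap
  -- `ε' - ε - 2 * τ`.
  obtain ⟨κ, hκ, hκε⟩ : ∃ κ > 0, ε * (1 + κ * R.card) + 2 * τ ≤ ε' := by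
    have hd : 0 < ε' - ε - 2 * τ := by linarith
    refine ⟨(ε' - ε - 2 * τ) / (ε * R.card + 1), by positivity, ?_⟩
    have : (ε' - ε - 2 * τ) / (ε * R.card + 1) * (ε * R.card) ≤ ε' - ε - 2 * τ := by
      rw [div_mul_eq_mul_div, div_le_iff₀ (by positivity)]
      nlinarith
    linarith
  choose φ c hφ using fun i => exists_scaled_rank (T i) hε hκ (h i)
  obtain ⟨Φ, hΦ1, hΦ2⟩ := exists_strictMono_sum R
  set K := dualBallImage (directSumMap p C T hT) with hK
  intro f hf hfW
  have hfK : f ∈ K := by simpa using iterDeriv_antitone ε' K (zero_le (a := ω ^ (β + 1))) hf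
  have hlt2 : Φ (fun i => φ i (f.comp (emb 𝕜 E p i))) < ω ^ (β + 1) :=
    hΦ2 (β + 1) _ fun i _ => (hφ i _ (comp_emb_mem hfK i)).1
  refine hlt2.not_ge (le_of_mem_iterDeriv (by linarith : 0 ≤ ε') hW
    (fun g => Φ fun i => φ i (g.comp (emb 𝕜 E p i))) (fun x hx hxW => ?_) _ f hf hfW)
  choose V hV hxV hVle hVd using fun i => (hφ i _ (comp_emb_mem hx i)).2.2.2
  refine ⟨⋂ i ∈ R, {g | toWeakDual ((toStrongDual g).comp (emb 𝕜 E p i)) ∈ V i},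
    R.finite_toSet.isOpen_biInter fun i _ => (hV i).preimage (continuous_weakDual_comp _),
    Set.mem_iInter₂.2 fun i _ => hxV i, fun y hy hyV _ => ?_,
    fun y hy z hz hyV hzV hyW hzW hyx hzx => ?_⟩
  · exact (hΦ1 _ _ fun i hi => hVle i _ (comp_emb_mem hy i) (Set.mem_iInter₂.1 hyV i hi)).1
  -- The weights come from one functional `ψ` representing the centre `x`, whatever represents `y`
  -- and `z`.
  · obtain ⟨ψ, hψ, rfl⟩ := mem_dualBallImage.1 hx
    have hyi := (hΦ1 _ _ fun i hi => hVle i _ (comp_emb_mem hy i) (Set.mem_iInter₂.1 hyV i hi)).2 hyx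
    have hzi := (hΦ1 _ _ fun i hi => hVle i _ (comp_emb_mem hz i) (Set.mem_iInter₂.1 hzV i hi)).2 hzx
    have hmain : ‖(y - z).comp (trunc 𝕜 E p R)‖ ≤ ε * (1 + κ * R.card) := by
      refine norm_comp_trunc_le (F := F) hε hκ.le hψ
        (c := fun i => c i ((ψ.comp (directSumMap p C T hT)).comp (emb 𝕜 E p i)))
        (fun i _ => (hφ i _ (comp_emb_mem hx i)).2.2.1 _ ?_) fun i hi => ?_
      · ext v
        simp [directSumMap_emb]
      · rw [ContinuousLinearMap.sub_comp]
        exact hVd i _ (comp_emb_mem hy i) _ (comp_emb_mem hz i) (Set.mem_iInter₂.1 hyV i hi)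
          (Set.mem_iInter₂.1 hzV i hi) (hyi i hi) (hzi i hi)
    have hy' := htail y hy hyW
    have hz' := htail z hz hzW
    rw [ContinuousLinearMap.sub_comp] at hmain
    have := norm_sub_le_of_approx y z (y.comp (trunc 𝕜 E p R)) (z.comp (trunc 𝕜 E p R))
    linarith

theorem iterDeriv_finite_sum_eq_empty [Fintype ι] {ε ε' : ℝ} (hε : 0 ≤ ε) (hlt : ε < ε')
    {β : Ordinal} (h : ∀ i, iterDeriv ε (dualBallImage (T i)) (ω ^ β) = ∅) :
    iterDeriv ε' (dualBallImage (directSumMap p C T hT)) (ω ^ (β + 1)) = ∅ := by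
  rw [Set.eq_empty_iff_forall_notMem]
  intro f hf
  refine notMem_of_tail_small hε le_rfl (by linarith) h Finset.univ isOpen_univ
    (fun g _ _ => ?_) f hf (Set.mem_univ _)
  have : g.comp (trunc 𝕜 E p Finset.univ) = g := by
    ext x
    rw [ContinuousLinearMap.comp_apply, trunc_univ]
  rw [this, sub_self]
  exact ContinuousLinearMap.opNorm_zero.le

/-- If `f` is not in `s • K`, neither is some truncation of it, and this persists on a weak-star
neighbourhood. Functionals representing points of `K` there have norm above `s` on the finitely many
coordinates, hence small tails, so `notMem_of_tail_small` excludes `f` from the iterate. -/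
theorem exists_shrink (hp : p.1 = 0 ∨ 1 < p.1) {ε ε' : ℝ} (hε : 0 ≤ ε) (hlt : ε < ε')
    {β : Ordinal} (h : ∀ i, iterDeriv ε (dualBallImage (T i)) (ω ^ β) = ∅) :
    ∃ s : ℝ, 0 < s ∧ s < 1 ∧
      ∀ f ∈ iterDeriv ε' (dualBallImage (directSumMap p C T hT)) (ω ^ (β + 1)),
        ((s : 𝕜)⁻¹) • f ∈ dualBallImage (directSumMap p C T hT) := by
  have hd : 0 < ε' - ε := by linarith
  have hτ : 0 < (ε' - ε) / (4 * (C + 1)) := by positivity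
  obtain ⟨θ, hθ, hθ1, hθt⟩ := exists_tail_small.{max u v, v} (𝕜 := 𝕜) hp hτ
  have hs : 0 < 1 - θ := by linarith
  refine ⟨1 - θ, hs, by linarith, fun f hf => ?_⟩
  set K := dualBallImage (directSumMap p C T hT) with hK
  have hcl : IsClosed {g : WeakDual 𝕜 (directSum 𝕜 E p) |
      (((1 - θ : ℝ) : 𝕜)⁻¹) • toStrongDual g ∈ K} :=
    (isCompact_dualBallImage _).isClosed.preimage (continuous_weakDual_smul _)
  by_contra hfs
  -- The truncations of `f` converge weak-star to `f`, and `K` is weak-star closed.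
  obtain ⟨R, hR⟩ : ∃ R : Finset ι, (((1 - θ : ℝ) : 𝕜)⁻¹) • f.comp (trunc 𝕜 E p R) ∉ K := by
    by_contra! hall
    refine hfs (hcl.mem_of_tendsto (f := fun R => toWeakDual (f.comp (trunc 𝕜 E p R)))
      (b := Filter.atTop) (x := toWeakDual f) ?_ (Filter.Eventually.of_forall hall))
    refine tendsto_iff_forall_eval_tendsto_topDualPairing.2 ?_
    exact fun x => (f.continuous.tendsto x).comp (tendsto_trunc x)
  refine notMem_of_tail_small (τ := (ε' - ε) / (4 * (C + 1)) * C) hε (by positivity) ?_ h R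
    (W := {g | (((1 - θ : ℝ) : 𝕜)⁻¹) • (toStrongDual g).comp (trunc 𝕜 E p R) ∉ K})
    (hcl.isOpen_compl.preimage (continuous_weakDual_comp (trunc 𝕜 E p R))) (fun g hg hgW => ?_)
    f hf hR
  · have : (ε' - ε) / (4 * (C + 1)) * C ≤ (ε' - ε) / 4 := by
      rw [div_mul_eq_mul_div, div_le_div_iff₀ (by positivity) (by positivity)]
      nlinarith [C.2]
    linarith
  · obtain ⟨φ, hφ, rfl⟩ := mem_dualBallImage.1 hg
    have hcomm : (φ.comp (directSumMap p C T hT)).comp (trunc 𝕜 E p R) =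
        (φ.comp (trunc 𝕜 F p R)).comp (directSumMap p C T hT) := by
      ext x
      simp only [ContinuousLinearMap.comp_apply, directSumMap_trunc]
    have hlarge : 1 - θ < ‖φ.comp (trunc 𝕜 F p R)‖ := by
      by_contra hle
      have := smul_mem_of_norm_le (T := directSumMap p C T hT) hs (not_lt.1 hle)
      rw [← hcomm] at this
      exact hgW this
    rw [hcomm, ← ContinuousLinearMap.sub_comp]
    refine (ContinuousLinearMap.opNorm_comp_le _ _).trans ?_
    gcongr
    · exact hθt φ R hφ hlarge
    · exact norm_directSumMap_le p C T hT

/-- Each block of `ω ^ (β + 1)` derivations shrinks the set by the factor `s`, since rescaling by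
`s⁻¹` only enlarges the separation. After finitely many blocks the diameter is at most `ε'`, and one
more derivation leaves nothing. -/
theorem iterDeriv_sum_eq_empty (hp : p.1 = 0 ∨ 1 < p.1) {ε ε' : ℝ} (hε : 0 ≤ ε) (hlt : ε < ε')
    {β : Ordinal} (h : ∀ i, iterDeriv ε (dualBallImage (T i)) (ω ^ β) = ∅) :
    iterDeriv ε' (dualBallImage (directSumMap p C T hT)) (ω ^ (β + 2)) = ∅ := by
  obtain ⟨s, hs, hs1, hsh⟩ := exists_shrink (hT := hT) hp hε hlt h
  have hε' : 0 < ε' := by linarith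
  set K := dualBallImage (directSumMap p C T hT) with hK
  have hiter : ∀ m : ℕ, ∀ f ∈ iterDeriv ε' K (ω ^ (β + 1) * m), (((s ^ m : ℝ) : 𝕜)⁻¹) • f ∈ K := by
    intro m
    induction m with
    | zero => simp
    | succ m ih =>
      intro f hf
      rw [Nat.cast_add_one, mul_add_one, iterDeriv_add] at hf
      have hsm : 0 < s ^ m := by positivity
      have h1 := map_mem_iterDeriv (a := (s ^ m)⁻¹) hε'.le (by positivity)
        (fun g => (((s ^ m : ℝ) : 𝕜)⁻¹) • g) (continuous_weakDual_smul _) (fun x y => ?_) ih _ f hf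
      · have h2 := hsh _ (iterDeriv_anti_eps hε'.le (by
          have : 1 ≤ (s ^ m)⁻¹ := one_le_inv_iff₀.2 ⟨hsm, pow_le_one₀ hs.le hs1.le⟩
          nlinarith) _ _ h1)
        rw [smul_smul] at h2
        rw [pow_succ', RCLike.ofReal_mul, mul_inv]
        exact h2
      · exact (norm_inv_smul_sub hsm x y).ge
  obtain ⟨m, hm⟩ : ∃ m : ℕ, s ^ m * (2 * C) ≤ ε' := by
    obtain ⟨m, hm⟩ := exists_pow_lt_of_lt_one (show 0 < ε' / (2 * C + 1) by positivity) hs1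
    refine ⟨m, ?_⟩
    rw [lt_div_iff₀ (by positivity)] at hm
    have : 0 < s ^ m := by positivity
    nlinarith
  have hnorm : ∀ f ∈ iterDeriv ε' K (ω ^ (β + 1) * m), ‖f‖ ≤ s ^ m * C := by
    intro f hf
    have hsm : 0 < s ^ m := by positivity
    have := (norm_le_of_mem_dualBallImage (hiter m f hf)).trans (norm_directSumMap_le p C T hT)
    exact (inv_mul_le_iff₀ hsm).1 ((norm_inv_smul hsm f).symm.trans_le this)
  have hempty : iterDeriv ε' K (ω ^ (β + 1) * m + 1) = ∅ := by
    rw [Set.eq_empty_iff_forall_notMem]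
    intro f hf
    rw [iterDeriv_add_one, mem_szDeriv_iff hε'.le] at hf
    obtain ⟨y, hy, z, hz, -, -, hyz⟩ := hf.2 Set.univ isOpen_univ (Set.mem_univ _)
    have := (norm_sub_le y z).trans (add_le_add (hnorm y hy) (hnorm z hz))
    linarith
  refine Set.subset_eq_empty (iterDeriv_antitone ε' K ?_) hempty
  have h1 : (ω : Ordinal) ^ (β + 2) = ω ^ (β + 1) * ω := by
    rw [show β + 2 = β + 1 + 1 by rw [add_assoc, one_add_one_eq_two], Ordinal.opow_add _ (β + 1) 1,
      Ordinal.opow_one]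
  have hpos : (0 : Ordinal) < ω ^ (β + 1) := Ordinal.opow_pos _ Ordinal.omega0_pos
  rw [h1]
  calc ω ^ (β + 1) * m + 1 ≤ ω ^ (β + 1) * m + ω ^ (β + 1) := by
        gcongr
        exact one_le_iff_pos.2 hpos
    _ = ω ^ (β + 1) * (m + 1 : ℕ) := by push_cast; rw [mul_add_one]
    _ ≤ ω ^ (β + 1) * ω := by
        gcongr
        exact (Ordinal.natCast_lt_omega0 _).le

end UpperBound

/-! ### Propagation of upper bounds through the construction -/

namespace BanachOp

variable {𝕜 : Type*} [RCLike 𝕜] {C : ℝ≥0}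

/-- For every `δ > ε` the `δ`-Szlenk index is at most `ω ^ β`. -/
def IndexBound (S : BanachOp.{u} 𝕜 C) (ε : ℝ) (β : Ordinal.{u}) : Prop :=
  ∀ δ > ε, iterDeriv δ (dualBallImage S.op) (ω ^ β) = ∅

theorem IndexBound.mono {S : BanachOp.{u} 𝕜 C} {ε : ℝ} {β γ : Ordinal.{u}}
    (h : S.IndexBound ε β) (hβ : β ≤ γ) : S.IndexBound ε γ := fun δ hδ =>
  Set.subset_eq_empty
    (iterDeriv_antitone δ _ (Ordinal.opow_le_opow_right Ordinal.omega0_pos hβ)) (h δ hδ)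

/-- A sum needs a strictly larger level than its summands. Quantifying over all `δ > ε` absorbs this
loss, so `ε` survives transfinitely many steps. -/
theorem IndexBound.copies {S : BanachOp.{u} 𝕜 C} {ε : ℝ} (hε : 0 ≤ ε) {β : Ordinal.{u}}
    (h : S.IndexBound ε β) (n : ℕ) : (S.copies n).IndexBound ε (β + 1) := by
  intro δ hδ
  obtain ⟨δ', h1, h2⟩ := exists_between hδ
  exact iterDeriv_finite_sum_eq_empty.{u, 0} (ι := Fin n) (T := fun _ => S.op)
    (hT := fun _ => S.norm_op_le) (hε.trans h1.le) h2 fun _ => h δ' h1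

theorem IndexBound.sum {ι : Type v} {r : SumExponent} (hr : r.1 = 0 ∨ 1 < r.1)
    {S : ι → BanachOp.{max u v} 𝕜 C} {ε : ℝ} (hε : 0 ≤ ε) {β : Ordinal}
    (h : ∀ i, (S i).IndexBound ε β) : (sum r S).IndexBound ε (β + 2) := by
  intro δ hδ
  obtain ⟨δ', h1, h2⟩ := exists_between hδ
  exact iterDeriv_sum_eq_empty.{u, v} (T := fun i => (S i).op)
    (hT := fun i => (S i).norm_op_le) hr (hε.trans h1.le) h2 fun i => h i δ' h1

theorem IndexBound.plus {r : SumExponent} (hr : r.1 = 0 ∨ 1 < r.1) {S : BanachOp.{u} 𝕜 C} {ε : ℝ}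
    (hε : 0 ≤ ε) {β : Ordinal.{u}} (h : S.IndexBound ε β) :
    (S.plus r).IndexBound ε (β + 3) := by
  have := IndexBound.sum.{u, 0} hr hε fun n : ℕ => h.copies hε (n + 1)
  rwa [add_assoc, show (1 : Ordinal.{u}) + 2 = 3 by norm_num] at this

theorem IndexBound.iter {r : SumExponent} (hr : r.1 = 0 ∨ 1 < r.1) {T : BanachOp.{u} 𝕜 C} {ε : ℝ}
    (hε : 0 ≤ ε) {γ : Ordinal.{u}} (h : T.IndexBound ε γ) (α : Ordinal.{u}) :
    (T.iter r α).IndexBound ε (γ + 3 * (α + 1)) := by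
  induction α using Ordinal.limitRecOn with
  | zero =>
    rw [iter_zero]
    exact h.mono le_self_add
  | add_one α ih =>
    rw [iter_add_one, mul_add_one _ (α + 1), ← add_assoc]
    exact ih.plus hr hε
  | limit α hα ih =>
    rw [iter_limit r T hα]
    -- The form `3 * (ξ + 1)` of the bound gives the uniform `3 * α` for all `ξ < α`, and the sum
    -- then costs `2 ≤ 3`.
    refine (IndexBound.sum.{u, u} hr hε (β := γ + 3 * α) fun i => ?_).mono ?_
    · refine (ih i.toOrd.1 i.toOrd.2).mono ?_
      gcongr
      exact add_one_le_of_lt i.toOrd.2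
    · rw [mul_add_one, ← add_assoc]
      gcongr
      norm_num

end BanachOp

end SzlenkOp

namespace SzlenkOp

open Order StrongDual WeakDual

/-! ### Index at most one forces compactness -/

section Compact

variable {𝕜 : Type*} [RCLike 𝕜]
  {E : Type u} [NormedAddCommGroup E] [NormedSpace 𝕜 E]
  {F : Type u} [NormedAddCommGroup F] [NormedSpace 𝕜 F]

theorem exists_finite_net_of_szDeriv_eq_empty {K : Set (StrongDual 𝕜 E)}
    (hK : IsCompact (toStrongDual (𝕜 := 𝕜) ⁻¹' K)) {ε : ℝ} (hε : 0 ≤ ε) (h : szDeriv ε K = ∅) :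
    ∃ t : Set (StrongDual 𝕜 E), t.Finite ∧ t ⊆ K ∧ ∀ f ∈ K, ∃ g ∈ t, ‖f - g‖ ≤ ε := by
  classical
  have hex : ∀ w ∈ toStrongDual (𝕜 := 𝕜) (E := E) ⁻¹' K, ∃ V : Set (WeakDual 𝕜 E),
      IsOpen V ∧ w ∈ V ∧ ∀ y ∈ K, ∀ z ∈ K, toWeakDual y ∈ V → toWeakDual z ∈ V → ‖y - z‖ ≤ ε :=
    fun w hw => notMem_szDeriv hε (by rw [h]; exact Set.notMem_empty (toStrongDual w)) hw
  choose! V hV hwV hVd using hex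
  obtain ⟨t, ht, hcov⟩ := hK.elim_nhds_subcover V fun w hw => (hV w hw).mem_nhds (hwV w hw)
  refine ⟨(fun w => toStrongDual w) '' (t : Set (WeakDual 𝕜 E)), t.finite_toSet.image _, ?_,
    fun f hf => ?_⟩
  · rintro _ ⟨w, hw, rfl⟩
    exact ht w hw
  · obtain ⟨w, hw, hfw⟩ := Set.mem_iUnion₂.1 (hcov (show toWeakDual f ∈ _ from hf))
    exact ⟨toStrongDual w, ⟨w, hw, rfl⟩,
      hVd w (ht w hw) f hf (toStrongDual w) (ht w hw) hfw (hwV w (ht w hw))⟩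

/-- A form of Schauder's theorem: an operator is compact as soon as the image of the dual ball is
totally bounded. -/
theorem isCompactOperator_of_finite_net [CompleteSpace F] (T : E →L[𝕜] F)
    (h : ∀ ε > 0, ∃ t : Set (StrongDual 𝕜 E), t.Finite ∧ t ⊆ dualBallImage T ∧
      ∀ f ∈ dualBallImage T, ∃ g ∈ t, ‖f - g‖ ≤ ε) : IsCompactOperator T := by
  refine (isCompactOperator_iff_isCompact_closure_image_closedBall (T : E →ₗ[𝕜] F) one_pos).2 ?_
  refine TotallyBounded.isCompact_of_isClosed (TotallyBounded.closure ?_) isClosed_closure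
  rw [Metric.totallyBounded_iff]
  intro ε hε
  obtain ⟨t, ht, htK, htε⟩ := h (ε / 8) (by positivity)
  have : Fintype t := ht.fintype
  -- Evaluation at the finite net maps the ball into a finite-dimensional space. Points with close
  -- values have close images under `T`: net error `ε / 8` times `‖x - x'‖ ≤ 2`, plus `ε / 4`, is `ε
  -- / 2`.
  let Φ : E → (t → 𝕜) := fun x f => f.1 x
  have hTB : TotallyBounded (Φ '' Metric.closedBall 0 1) := by
    suffices Bornology.IsBounded (Φ '' Metric.closedBall 0 1) from
      this.isCompact_closure.totallyBounded.subset subset_closure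
    refine (Metric.isBounded_iff_subset_closedBall 0).2 ⟨‖T‖, ?_⟩
    rintro _ ⟨x, hx, rfl⟩
    rw [mem_closedBall_zero_iff] at hx ⊢
    refine (pi_norm_le_iff_of_nonneg (norm_nonneg _)).2 fun f => ?_
    have := f.1.le_of_opNorm_le_of_le (norm_le_of_mem_dualBallImage (htK f.2)) hx
    rwa [mul_one] at this
  obtain ⟨s, hsub, hsfin, hcov⟩ := Metric.finite_approx_of_totallyBounded hTB (ε / 4) (by positivity)
  obtain ⟨s', hs', hsfin', hcov'⟩ := (Set.exists_subset_image_finite_and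
    (p := fun s => Φ '' Metric.closedBall 0 1 ⊆ ⋃ y ∈ s, Metric.ball y (ε / 4))).1
      ⟨s, hsub, hsfin, hcov⟩
  refine ⟨T '' s', hsfin'.image _, ?_⟩
  rintro _ ⟨x, hx, rfl⟩
  obtain ⟨_, ⟨x', hx', rfl⟩, hxx'⟩ := Set.mem_iUnion₂.1 (hcov' ⟨x, hx, rfl⟩)
  refine Set.mem_iUnion₂.2 ⟨T x', ⟨x', hx', rfl⟩, ?_⟩
  have hx1 : ‖x - x'‖ ≤ 2 := by
    have h1 := mem_closedBall_zero_iff.1 hx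
    have h2 := mem_closedBall_zero_iff.1 (hs' hx')
    linarith [norm_sub_le x x']
  rw [Metric.mem_ball, dist_eq_norm]
  change ‖T x - T x'‖ < ε
  rw [← map_sub]
  refine lt_of_le_of_lt (NormedSpace.norm_le_dual_bound 𝕜 (T (x - x')) (M := ε / 2)
    (by positivity) fun φ => ?_) (half_lt_self hε)
  rcases eq_or_ne φ 0 with rfl | hφ
  · simp
  have hpos : 0 < ‖φ‖ := norm_pos_iff.2 hφ
  have hmem := smul_mem_of_norm_le (T := T) hpos le_rfl
  obtain ⟨g, hg, hfg⟩ := htε _ hmem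
  have h1 : ‖g (x - x')‖ ≤ ε / 4 := by
    have h2 := (norm_le_pi_norm (Φ x - Φ x') ⟨g, hg⟩).trans
      ((dist_eq_norm _ _).symm.le.trans (Metric.mem_ball.1 hxx').le)
    rw [map_sub]
    exact h2
  have h3 : ‖(((‖φ‖ : 𝕜)⁻¹) • φ.comp T - g) (x - x')‖ ≤ ε / 8 * 2 :=
    ContinuousLinearMap.le_of_opNorm_le_of_le _ hfg hx1
  have h4 : ‖(((‖φ‖ : 𝕜)⁻¹) • φ.comp T) (x - x')‖ ≤ ε / 2 := by
    have : (((‖φ‖ : 𝕜)⁻¹) • φ.comp T) (x - x') =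
      (((‖φ‖ : 𝕜)⁻¹) • φ.comp T - g) (x - x') + g (x - x') := by
        rw [sub_apply]; ring
    rw [this]
    refine (norm_add_le _ _).trans ?_
    linarith
  rw [smul_apply, norm_smul, norm_inv, RCLike.norm_ofReal, abs_norm,
    inv_mul_le_iff₀ hpos] at h4
  rw [mul_comm]
  exact h4

theorem isCompactOperator_of_index_le_one [CompleteSpace F] (T : E →L[𝕜] F)
    (h : index T ≤ ((1 : Ordinal.{u}) : WithTop Ordinal.{u})) : IsCompactOperator T := by
  refine isCompactOperator_of_finite_net T fun ε hε => ?_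
  have := index_le_iff.1 h ε hε
  rw [← zero_add 1, iterDeriv_add_one, iterDeriv_zero] at this
  exact exists_finite_net_of_szDeriv_eq_empty (isCompact_dualBallImage T) hε.le this

end Compact

/-! ### Measures on dyadic trees -/

section DyadicMeasure

variable {X : Type*}

/-- Averages of point masses along a dyadic tree. -/
noncomputable def dyadicAverage [MeasurableSpace X] (q : List Bool → X) : ℕ → List Bool → Measure X
  | 0, l => Measure.dirac (q l)
  | n + 1, l => (2⁻¹ : ℝ≥0∞) • (dyadicAverage q n (true :: l) + dyadicAverage q n (false :: l))

variable {D : List Bool → Set X} {q : List Bool → X}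

theorem dyadicAverage_univ [MeasurableSpace X] (n : ℕ) (l : List Bool) : dyadicAverage q n l Set.univ = 1 := by
  induction n generalizing l with
  | zero => simp [dyadicAverage]
  | succ n ih =>
    simp only [dyadicAverage, Measure.smul_apply, Measure.add_apply, ih, smul_eq_mul]
    rw [one_add_one_eq_two, ENNReal.inv_mul_cancel two_ne_zero ENNReal.ofNat_ne_top]

theorem dyadicAverage_compl [MeasurableSpace X] (hD : ∀ l, MeasurableSet (D l)) (hsub : ∀ b l, D (b :: l) ⊆ D l)
    (hq : ∀ l, q l ∈ D l) (n : ℕ) (l : List Bool) : dyadicAverage q n l (D l)ᶜ = 0 := by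
  induction n generalizing l with
  | zero =>
    rw [dyadicAverage, Measure.dirac_apply' _ (hD l).compl]
    simp [hq l]
  | succ n ih =>
    have h (b : Bool) : dyadicAverage q n (b :: l) (D l)ᶜ = 0 :=
      measure_mono_null (Set.compl_subset_compl.2 (hsub b l)) (ih (b :: l))
    simp [dyadicAverage, h]

theorem subset_of_append (hsub : ∀ b l, D (b :: l) ⊆ D l) (k l : List Bool) :
    D (k ++ l) ⊆ D l := by
  induction k with
  | nil => exact subset_rfl
  | cons b k ih => exact (hsub b _).trans ih

/-- Nodes grow at the head of the list, so the last entry of `k` names the child of `l` above `k ++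
l`. The average through the other child gives that node no mass, and each level contributes a factor
`2⁻¹`. -/
theorem dyadicAverage_apply [MeasurableSpace X] (hD : ∀ l, MeasurableSet (D l)) (hsub : ∀ b l, D (b :: l) ⊆ D l)
    (hdisj : ∀ l, Disjoint (D (true :: l)) (D (false :: l))) (hq : ∀ l, q l ∈ D l) (n : ℕ)
    (l k : List Bool) (hk : k.length ≤ n) :
    dyadicAverage q n l (D (k ++ l)) = (2⁻¹ : ℝ≥0∞) ^ k.length := by
  have hnil : ∀ n l, dyadicAverage q n l (D l) = 1 := by
    intro n l
    rw [← dyadicAverage_univ (q := q) n l, ← measure_add_measure_compl (hD l),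
      dyadicAverage_compl hD hsub hq, add_zero]
  induction n generalizing l k with
  | zero =>
    rw [List.length_eq_zero_iff.1 (Nat.le_zero.1 hk)]
    simpa using hnil 0 l
  | succ n ih =>
    rcases List.eq_nil_or_concat k with rfl | ⟨k', b, rfl⟩
    · simpa using hnil (n + 1) l
    · rw [List.concat_eq_append] at hk ⊢
      simp only [List.length_append, List.length_singleton, Nat.add_le_add_iff_right] at hk
      have h1 : ∀ c, c ≠ b → dyadicAverage q n (c :: l) (D (k' ++ b :: l)) = 0 := by
        intro c hc
        refine measure_mono_null ?_ (dyadicAverage_compl hD hsub hq n (c :: l))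
        refine (subset_of_append hsub k' (b :: l)).trans (Set.subset_compl_iff_disjoint_right.2 ?_)
        cases b <;> cases c
        · exact absurd rfl hc
        · exact (hdisj l).symm
        · exact hdisj l
        · exact absurd rfl hc
      have h2 := ih (b :: l) k' hk
      simp only [dyadicAverage, Measure.smul_apply, Measure.add_apply, smul_eq_mul,
        List.append_assoc, List.singleton_append, List.length_append, List.length_singleton]
      rw [pow_succ']
      congr 1
      cases b
      · rw [h2, h1 true (by simp), zero_add]
      · rw [h2, h1 false (by simp), add_zero]

/-- A tree of closed sets, each the disjoint union of its two children, in a compact space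
carries a probability measure that halves at each step. -/
theorem exists_dyadic_measure [TopologicalSpace X] [MeasurableSpace X] [CompactSpace X] [T2Space X] [BorelSpace X]
    (hcl : ∀ l, IsClosed (D l)) (hne : ∀ l, (D l).Nonempty) (hnil : D [] = Set.univ)
    (hun : ∀ l, D l = D (true :: l) ∪ D (false :: l))
    (hdisj : ∀ l, Disjoint (D (true :: l)) (D (false :: l))) :
    ∃ μ : Measure X, IsProbabilityMeasure μ ∧ ∀ l, μ (D l) = (2⁻¹ : ℝ≥0∞) ^ l.length := by
  have hsub : ∀ b l, D (b :: l) ⊆ D l := by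
    intro b l
    rw [hun l]
    cases b
    exacts [Set.subset_union_right, Set.subset_union_left]
  have hopen : ∀ l, IsOpen (D l) := by
    intro l
    induction l with
    | nil => rw [hnil]; exact isOpen_univ
    | cons b l ih =>
      have h (b : Bool) : D (b :: l) = D l \ D ((!b) :: l) := by
        rw [hun l]
        cases b
        · exact (Set.union_sdiff_cancel_left (hdisj l).le_bot).symm
        · exact (Set.union_sdiff_cancel_right (hdisj l).le_bot).symm
      rw [h]
      exact ih.sdiff (hcl _)
  have hclopen : ∀ l, IsClopen (D l) := fun l => ⟨hcl l, hopen l⟩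
  have hmeas : ∀ l, MeasurableSet (D l) := fun l => (hcl l).measurableSet
  choose q hq using hne
  have hint : ∀ (μ : ProbabilityMeasure X) (l : List Bool),
      ∫ x, BoundedContinuousFunction.indicator (D l) (hclopen l) x ∂(μ : Measure X) =
        (μ : Measure X).real (D l) := fun μ l => by
    have : ⇑(BoundedContinuousFunction.indicator (D l) (hclopen l)) =
        (D l).indicator (fun _ => (1 : ℝ)) := rfl
    rw [this, integral_indicator_const _ (hmeas l), smul_eq_mul, mul_one]
  -- The nodes are clopen, so prescribing their measures is a closed condition. The dyadic averages
  -- satisfy it down to any level, and compactness of the space of probability measures gives all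
  -- levels at once.
  let P : ℕ → Set (ProbabilityMeasure X) := fun n =>
    {μ | ∀ l : List Bool, l.length ≤ n → (μ : Measure X).real (D l) = (2⁻¹ : ℝ) ^ l.length}
  have hPcl : ∀ n, IsClosed (P n) := by
    intro n
    simp only [P, Set.ofPred_forall]
    refine isClosed_iInter fun l => isClosed_iInter fun _ => ?_
    simp only [← hint]
    exact isClosed_eq (ProbabilityMeasure.continuous_integral_boundedContinuousFunction _)
      continuous_const
  have hPne : ∀ n, (P n).Nonempty := by
    intro n
    refine ⟨⟨dyadicAverage q n [], ⟨dyadicAverage_univ n []⟩⟩, fun l hl => ?_⟩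
    have := dyadicAverage_apply hmeas hsub hdisj hq n [] l hl
    rw [List.append_nil] at this
    simp [Measure.real, this]
  obtain ⟨μ, hμ⟩ := IsCompact.nonempty_iInter_of_sequence_nonempty_isCompact_isClosed P
    (fun n μ hμ l hl => hμ l (hl.trans n.le_succ)) hPne (hPcl 0).isCompact hPcl
  refine ⟨μ, inferInstance, fun l => ?_⟩
  have := Set.mem_iInter.1 hμ l.length l le_rfl
  rw [← ENNReal.toReal_eq_toReal_iff' (measure_ne_top _ _) (by simp)]
  simpa [Measure.real] using this

end DyadicMeasure

end SzlenkOp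

namespace SzlenkOp

open Order StrongDual WeakDual

/-! ### Dyadic trees in sets that survive derivation -/

section Tree

variable {𝕜 : Type*} [RCLike 𝕜] {E : Type u} [NormedAddCommGroup E] [NormedSpace 𝕜 E]

/-- Two points of `L ∩ V` differ by more than `ε` at some `x` of the unit ball. Allowing `ε / 4`
around each value leaves a gap of `ε / 2`, which persists on weak-star closures. -/
theorem exists_split {L : Set (StrongDual 𝕜 E)} {ε : ℝ} (hε : 0 < ε) (h : L ⊆ szDeriv ε L)
    (V : {V : Set (WeakDual 𝕜 E) // IsOpen V ∧ (V ∩ toStrongDual ⁻¹' L).Nonempty}) :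
    ∃ (x : E) (V' : Bool → {V : Set (WeakDual 𝕜 E) // IsOpen V ∧
      (V ∩ toStrongDual ⁻¹' L).Nonempty}), ‖x‖ ≤ 1 ∧ (∀ b, (V' b).1 ⊆ V.1) ∧
      ∀ f ∈ closure ((V' true).1 ∩ toStrongDual ⁻¹' L),
        ∀ g ∈ closure ((V' false).1 ∩ toStrongDual ⁻¹' L), ε / 2 ≤ ‖f x - g x‖ := by
  obtain ⟨V, hV, w, hwV, hwL⟩ := V
  obtain ⟨y, hy, z, hz, hyV, hzV, hyz⟩ := ((mem_szDeriv_iff hε.le).1 (h hwL)).2 V hV hwV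
  obtain ⟨x, hx, hxyz⟩ := ContinuousLinearMap.exists_lt_apply_of_lt_opNorm _ hyz
  let U : StrongDual 𝕜 E → Set (WeakDual 𝕜 E) := fun a => V ∩ {f | ‖f x - a x‖ < ε / 4}
  have hU : ∀ a, IsOpen (U a) := fun a => hV.inter
    (isOpen_lt ((WeakDual.eval_continuous x).sub continuous_const).norm continuous_const)
  have hmem : ∀ a ∈ L, toWeakDual a ∈ V → (U a ∩ toStrongDual ⁻¹' L).Nonempty := fun a ha haV =>
    ⟨toWeakDual a, ⟨haV, by simp [hε]⟩, ha⟩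
  have hcl : ∀ a, ∀ f ∈ closure (U a ∩ toStrongDual ⁻¹' L), ‖f x - a x‖ ≤ ε / 4 := by
    intro a
    exact closure_minimal (t := {f : WeakDual 𝕜 E | ‖f x - a x‖ ≤ ε / 4})
      (fun f hf => le_of_lt (show ‖f x - a x‖ < ε / 4 from hf.1.2))
      (isClosed_le ((WeakDual.eval_continuous x).sub continuous_const).norm continuous_const)
  refine ⟨x, fun b => if b then ⟨U y, hU y, hmem y hy hyV⟩ else ⟨U z, hU z, hmem z hz hzV⟩, hx.le,
    fun b => ?_, fun f hf g hg => ?_⟩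
  · cases b <;> exact Set.inter_subset_left
  · have h1 := hcl y f hf
    have h2 := hcl z g hg
    rw [sub_apply] at hxyz
    have h3 : y x - z x = (f x - g x) - (f x - y x) + (g x - z x) := by ring
    rw [h3] at hxyz
    have h4 := norm_add_le ((f x - g x) - (f x - y x)) (g x - z x)
    have h5 := norm_sub_le (f x - g x) (f x - y x)
    linarith

theorem exists_dyadic_tree {L : Set (StrongDual 𝕜 E)} (hL : L.Nonempty) {ε : ℝ} (hε : 0 < ε)
    (h : L ⊆ szDeriv ε L) :
    ∃ (D : List Bool → Set (WeakDual 𝕜 E)) (x : List Bool → E), (∀ l, ‖x l‖ ≤ 1) ∧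
      (∀ l, IsClosed (D l)) ∧ (∀ l, (D l ∩ toStrongDual ⁻¹' L).Nonempty) ∧
      (∀ b l, D (b :: l) ⊆ D l) ∧
      ∀ l, ∀ f ∈ D (true :: l), ∀ g ∈ D (false :: l), ε / 2 ≤ ‖f (x l) - g (x l)‖ := by
  choose x V hx hV hsep using exists_split hε h
  obtain ⟨y, hy⟩ := hL
  let V₀ : {V : Set (WeakDual 𝕜 E) // IsOpen V ∧ (V ∩ toStrongDual ⁻¹' L).Nonempty} :=
    ⟨Set.univ, isOpen_univ, toWeakDual y, Set.mem_univ _, hy⟩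
  let N : List Bool → {V : Set (WeakDual 𝕜 E) // IsOpen V ∧ (V ∩ toStrongDual ⁻¹' L).Nonempty} :=
    fun l => List.rec V₀ (fun b _ W => V W b) l
  refine ⟨fun l => closure ((N l).1 ∩ toStrongDual ⁻¹' L), fun l => x (N l), fun l => hx _,
    fun l => isClosed_closure, fun l => ?_, fun b l => ?_, fun l => hsep (N l)⟩
  · obtain ⟨w, hw⟩ := (N l).2.2
    exact ⟨w, subset_closure hw, hw.2⟩
  · exact closure_mono (Set.inter_subset_inter_left _ (hV (N l) b))

end Tree

section Oscillation

/-- Countably many balls of radius `δ / 2` cover the scalars, so one has a preimage of positive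
measure. The functions are treated one at a time. -/
theorem exists_small_oscillation {X 𝕜 : Type*} [MeasurableSpace X] [RCLike 𝕜] {μ : Measure X}
    {t : Set (X → 𝕜)} (ht : t.Finite) (hm : ∀ g ∈ t, Measurable g) {B : Set X}
    (hB : MeasurableSet B) (hpos : μ B ≠ 0) {δ : ℝ} (hδ : 0 < δ) :
    ∃ A ⊆ B, MeasurableSet A ∧ μ A ≠ 0 ∧ ∀ g ∈ t, ∀ x ∈ A, ∀ y ∈ A, ‖g x - g y‖ ≤ δ := by
  induction t, ht using Set.Finite.induction_on with
  | empty => exact ⟨B, subset_rfl, hB, hpos, by simp⟩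
  | @insert g t _ _ ih =>
    obtain ⟨A, hAB, hA, hApos, hosc⟩ := ih fun f hf => hm f (Set.mem_insert_of_mem g hf)
    have hg := hm g (Set.mem_insert g t)
    have hcov : A = ⋃ n, A ∩ g ⁻¹' Metric.ball (TopologicalSpace.denseSeq 𝕜 n) (δ / 2) := by
      rw [← Set.inter_iUnion, eq_comm, Set.inter_eq_left]
      intro x _
      obtain ⟨n, hn⟩ := (TopologicalSpace.denseRange_denseSeq 𝕜).exists_dist_lt (g x) (half_pos hδ)
      exact Set.mem_iUnion.2 ⟨n, hn⟩
    rw [hcov] at hApos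
    obtain ⟨n, hn⟩ := exists_measure_pos_of_not_measure_iUnion_null hApos
    refine ⟨_, Set.inter_subset_left.trans hAB, hA.inter (hg measurableSet_ball), hn.ne', ?_⟩
    rintro f (rfl | hf) x hx y hy
    · have h1 := Metric.mem_ball.1 hx.2
      have h2 := Metric.mem_ball.1 hy.2
      rw [← dist_eq_norm]
      exact (dist_triangle_right _ _ _).trans (by linarith)
    · exact hosc f hf x hx.1 y hy.1

end Oscillation

/-! ### Asplund operators have a Szlenk index -/

section Asplund

theorem Lp_ae_norm_sub_le {X 𝕜 : Type*} [MeasurableSpace X] [RCLike 𝕜] {μ : Measure X}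
    (f g : Lp 𝕜 ∞ μ) : ∀ᵐ x ∂μ, ‖f x - g x‖ ≤ ‖f - g‖ := by
  have h := ae_le_eLpNormEssSup (f := ⇑(f - g)) (μ := μ)
  filter_upwards [h, Lp.coeFn_sub f g] with x hx hfg
  rw [hfg, Pi.sub_apply] at hx
  have hfin := Lp.eLpNorm_ne_top (f - g)
  rw [Lp.norm_def]
  rw [eLpNorm_exponent_top] at hfin ⊢
  rw [← ENNReal.ofReal_le_iff_le_toReal hfin, ofReal_norm]
  exact hx

variable {𝕜 : Type} [RCLike 𝕜]
  {E : Type u} [NormedAddCommGroup E] [NormedSpace 𝕜 E]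
  {F : Type u} [NormedAddCommGroup F] [NormedSpace 𝕜 F]

/-- Evaluation of functionals on a compact set of the weak-star dual. -/
noncomputable def evalCompact (X : Set (WeakDual 𝕜 F)) [CompactSpace X]
    (hX : ∀ φ ∈ X, ‖toStrongDual φ‖ ≤ 1) : F →L[𝕜] C(X, 𝕜) :=
  LinearMap.mkContinuous
    { toFun := fun y => ⟨fun φ => φ.1 y, (WeakDual.eval_continuous y).comp continuous_subtype_val⟩
      map_add' := fun y z => by ext φ; exact map_add φ.1 y z
      map_smul' := fun c y => by ext φ; exact map_smul φ.1 c y } 1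
    fun y => (ContinuousMap.norm_le _ (by positivity)).2 fun φ =>
      (toStrongDual φ.1).le_of_opNorm_le (hX φ.1 φ.2) y

/-- An Asplund operator does not admit a dyadic tree of functionals separated by the images of
points of the unit ball. -/
theorem IsAsplund.false_of_tree {T : E →L[𝕜] F} (hT : IsAsplund T) (X : Set (WeakDual 𝕜 F))
    [CompactSpace X] (hX : ∀ φ ∈ X, ‖toStrongDual φ‖ ≤ 1) (D : List Bool → Set X)
    (hcl : ∀ l, IsClosed (D l)) (hne : ∀ l, (D l).Nonempty) (hnil : D [] = Set.univ)
    (hun : ∀ l, D l = D (true :: l) ∪ D (false :: l))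
    (x : List Bool → E) (hx : ∀ l, ‖x l‖ ≤ 1) {ε : ℝ} (hε : 0 < ε)
    (hsep : ∀ l, ∀ φ ∈ D (true :: l), ∀ ψ ∈ D (false :: l),
      ε ≤ ‖φ.1 (T (x l)) - ψ.1 (T (x l))‖) : False := by
  have hdisj : ∀ l, Disjoint (D (true :: l)) (D (false :: l)) := by
    intro l
    rw [Set.disjoint_left]
    intro φ h1 h2
    have := hsep l φ h1 φ h2
    rw [sub_self, norm_zero] at this
    linarith
  let _ : MeasurableSpace X := borel X
  have : BorelSpace X := ⟨rfl⟩
  obtain ⟨μ, hμ, hμD⟩ := exists_dyadic_measure hcl hne hnil hun hdisj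
  let S : F →L[𝕜] Lp 𝕜 ∞ μ := (ContinuousMap.toLp ∞ μ 𝕜).comp (evalCompact X hX)
  have hS : ∀ y : F, S y =ᵐ[μ] fun φ => φ.1 y := fun y => ContinuousMap.coeFn_toLp μ _
  -- Any tolerance below `1` would do, as only `μ B ≠ 0` is used. Scalars in `Type` put `X` in `Type
  -- u`, as the definition demands.
  obtain ⟨B, hB, hμB, hcomp⟩ := hT X μ S (1 / 2) (by norm_num)
  have hBpos : μ B ≠ 0 := by
    intro h0
    rw [Measure.real, Measure.real, h0, measure_univ] at hμB
    norm_num at hμB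
  have hδ : 0 < ε / 4 := by positivity
  obtain ⟨t, ht, hcov⟩ := Metric.totallyBounded_iff.1
    (hcomp.totallyBounded.subset subset_closure) (ε / 4) hδ
  obtain ⟨A, hAB, hA, hApos, hosc⟩ := exists_small_oscillation (μ := μ)
    (t := (fun g : Lp 𝕜 ∞ μ => (g : X → 𝕜)) '' t) (ht.image _) (by
      rintro _ ⟨g, _, rfl⟩
      exact (Lp.stronglyMeasurable g).measurable) hB hBpos hδ
  have hD : ∀ l, MeasurableSet (D l) := fun l => (hcl l).measurableSet
  -- On `A` the function `φ ↦ φ (T (x l))` is almost everywhere within `ε / 4` of a net function of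
  -- oscillation at most `ε / 4`. Points in both children would differ by at most `3 * ε / 4 < ε`.
  -- So `A` lies almost entirely in nodes of measure `2⁻¹ ^ n` for every `n`, and is null.
  have hone : ∀ l, μ (A ∩ D (true :: l)) = 0 ∨ μ (A ∩ D (false :: l)) = 0 := by
    intro l
    by_contra! hboth
    let g : Lp 𝕜 ∞ μ := ((Lp.memLp (S (T (x l)))).indicator hB).toLp _
    have hg : g =ᵐ[μ] B.indicator (S (T (x l))) := MemLp.coeFn_toLp _
    obtain ⟨y, hy, hgy⟩ := Set.mem_iUnion₂.1 (hcov ⟨x l, hx l, hg⟩)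
    have hae : ∀ᵐ φ ∂μ, φ ∈ A → ‖φ.1 (T (x l)) - y φ‖ ≤ ε / 4 := by
      filter_upwards [hg, hS (T (x l)), Lp_ae_norm_sub_le g y] with φ h1 h2 h3 hφ
      rw [h1, Set.indicator_of_mem (hAB hφ), h2] at h3
      refine h3.trans ?_
      rw [← dist_eq_norm]
      exact (Metric.mem_ball.1 hgy).le
    have hpick : ∀ b, μ (A ∩ D (b :: l)) ≠ 0 →
        ∃ φ ∈ A ∩ D (b :: l), ‖φ.1 (T (x l)) - y φ‖ ≤ ε / 4 := by
      intro b hb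
      by_contra! hall
      refine hb (measure_mono_null (fun φ hφ => ?_) hae)
      intro hle
      exact (hall φ hφ).not_ge (hle hφ.1)
    obtain ⟨φ, hφ, h1⟩ := hpick true hboth.1
    obtain ⟨ψ, hψ, h2⟩ := hpick false hboth.2
    have h3 := hosc _ ⟨y, hy, rfl⟩ φ hφ.1 ψ hψ.1
    have h4 := hsep l φ hφ.2 ψ hψ.2
    have h5 : φ.1 (T (x l)) - ψ.1 (T (x l)) =
        (φ.1 (T (x l)) - y φ) - (ψ.1 (T (x l)) - y ψ) + (y φ - y ψ) := by ring
    rw [h5] at h4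
    have h6 := norm_add_le ((φ.1 (T (x l)) - y φ) - (ψ.1 (T (x l)) - y ψ)) (y φ - y ψ)
    have h7 := norm_sub_le (φ.1 (T (x l)) - y φ) (ψ.1 (T (x l)) - y ψ)
    linarith
  have hbranch : ∀ n : ℕ, ∃ l : List Bool, l.length = n ∧ μ (A \ D l) = 0 := by
    intro n
    induction n with
    | zero => exact ⟨[], rfl, by simp [hnil]⟩
    | succ n ih =>
      obtain ⟨l, hl, h0⟩ := ih
      rcases hone l with h | h
      · refine ⟨false :: l, by simp [hl], measure_mono_null (fun φ hφ => ?_) (measure_union_null h0 h)⟩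
        by_cases hφl : φ ∈ D l
        · rw [hun] at hφl
          exact Or.inr ⟨hφ.1, hφl.resolve_right hφ.2⟩
        · exact Or.inl ⟨hφ.1, hφl⟩
      · refine ⟨true :: l, by simp [hl], measure_mono_null (fun φ hφ => ?_) (measure_union_null h0 h)⟩
        by_cases hφl : φ ∈ D l
        · rw [hun] at hφl
          exact Or.inr ⟨hφ.1, hφl.resolve_left hφ.2⟩
        · exact Or.inl ⟨hφ.1, hφl⟩
  have hle : ∀ n : ℕ, μ A ≤ (2⁻¹ : ℝ≥0∞) ^ n := by
    intro n
    obtain ⟨l, rfl, h0⟩ := hbranch n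
    rw [← hμD l]
    calc μ A ≤ μ (D l ∪ A \ D l) := measure_mono fun φ hφ => by
          by_cases h : φ ∈ D l
          exacts [Or.inl h, Or.inr ⟨hφ, h⟩]
      _ ≤ μ (D l) + μ (A \ D l) := measure_union_le _ _
      _ = μ (D l) := by rw [h0, add_zero]
  exact hApos (le_antisymm (ge_of_tendsto'
    (ENNReal.tendsto_pow_atTop_nhds_zero_of_lt_one (by norm_num)) hle) zero_le)

/-- The tree in `L` is pulled back along `φ ↦ φ.comp T` to the dual ball of `F`, where nodes are
compact, and then restricted to the functionals met at every level. There each node is the disjoint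
union of its children. -/
theorem IsAsplund.not_subset_szDeriv {T : E →L[𝕜] F} (hT : IsAsplund T)
    {L : Set (StrongDual 𝕜 E)} (hL : L.Nonempty) (hLT : L ⊆ dualBallImage T) {ε : ℝ} (hε : 0 < ε) :
    ¬ L ⊆ szDeriv ε L := by
  intro h
  obtain ⟨D, x, hx, hcl, hne, hsub, hsep⟩ := exists_dyadic_tree hL hε h
  let D' : List Bool → Set (WeakDual 𝕜 F) := fun l =>
    toStrongDual ⁻¹' Metric.closedBall 0 1 ∩ {φ | toWeakDual ((toStrongDual φ).comp T) ∈ D l}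
  have hcl' : ∀ l, IsClosed (D' l) := fun l =>
    (WeakDual.isCompact_closedBall 0 1).isClosed.inter
      ((hcl l).preimage (continuous_weakDual_comp T))
  have hcpt' : ∀ l, IsCompact (D' l) := fun l =>
    (WeakDual.isCompact_closedBall 0 1).of_isClosed_subset (hcl' l) Set.inter_subset_left
  have hsub' : ∀ b l, D' (b :: l) ⊆ D' l := fun b l φ hφ => ⟨hφ.1, hsub b l hφ.2⟩
  have hne' : ∀ l, (D' l).Nonempty := by
    intro l
    obtain ⟨f, hf, hfL⟩ := hne l
    obtain ⟨φ, hφ, hφf⟩ := mem_dualBallImage.1 (hLT hfL)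
    refine ⟨toWeakDual φ, mem_closedBall_zero_iff.2 hφ, ?_⟩
    change toWeakDual (φ.comp T) ∈ D l
    rw [hφf]
    exact hf
  have hsep' : ∀ l, ∀ φ ∈ D' (true :: l), ∀ ψ ∈ D' (false :: l),
      ε / 2 ≤ ‖φ (T (x l)) - ψ (T (x l))‖ := fun l φ hφ ψ hψ => hsep l _ hφ.2 _ hψ.2
  have hdisj : ∀ l φ, φ ∈ D' (true :: l) → φ ∉ D' (false :: l) := by
    intro l φ h1 h2
    have := hsep' l φ h1 φ h2
    rw [sub_self, norm_zero] at this
    linarith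
  have hunique : ∀ (φ : WeakDual 𝕜 F) (l k : List Bool), l.length = k.length → φ ∈ D' l →
      φ ∈ D' k → l = k := by
    intro φ l
    induction l with
    | nil => exact fun k hk _ _ => (List.length_eq_zero_iff.1 hk.symm).symm
    | cons b l ih =>
      rintro (_ | ⟨c, k⟩) hk h1 h2
      · simp at hk
      · obtain rfl := ih k (by simpa using hk) (hsub' _ _ h1) (hsub' _ _ h2)
        cases b <;> cases c
        · rfl
        · exact absurd h1 (hdisj _ _ h2)
        · exact absurd h2 (hdisj _ _ h1)
        · rfl
  let X : Set (WeakDual 𝕜 F) := ⋂ n : ℕ, ⋃ l ∈ {l : List Bool | l.length = n}, D' l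
  have hXcl : IsClosed X := isClosed_iInter fun n =>
    (List.finite_length_eq Bool n).isClosed_biUnion fun l _ => hcl' l
  have hXball : X ⊆ toStrongDual ⁻¹' Metric.closedBall 0 1 := by
    intro φ hφ
    obtain ⟨l, _, hl⟩ := Set.mem_iUnion₂.1 (Set.mem_iInter.1 hφ 0)
    exact hl.1
  have : CompactSpace X := isCompact_iff_compactSpace.1
    ((WeakDual.isCompact_closedBall 0 1).of_isClosed_subset hXcl hXball)
  refine hT.false_of_tree X (fun φ hφ => mem_closedBall_zero_iff.1 (hXball hφ))
    (fun l => Subtype.val ⁻¹' D' l) (fun l => (hcl' l).preimage continuous_subtype_val)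
    (fun l => ?_) ?_ (fun l => ?_) x hx (half_pos hε) (fun l φ hφ ψ hψ => hsep' l _ hφ _ hψ)
  -- A point on an infinite branch through `l` lies in `X`: extensions of `l` cover the levels
  -- beyond `l`, and suffixes of `l`, its ancestors, the levels before.
  · obtain ⟨φ, hφ⟩ := IsCompact.nonempty_iInter_of_sequence_nonempty_isCompact_isClosed
      (fun k : ℕ => D' (List.replicate k true ++ l)) (fun k => hsub' true _) (fun k => hne' _)
      (hcpt' _) (fun k => hcl' _)
    rw [Set.mem_iInter] at hφ
    refine ⟨⟨φ, Set.mem_iInter.2 fun n => ?_⟩, hφ 0⟩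
    rcases le_total l.length n with hn | hn
    · exact Set.mem_iUnion₂.2 ⟨List.replicate (n - l.length) true ++ l, by simp [hn], hφ _⟩
    · refine Set.mem_iUnion₂.2 ⟨l.drop (l.length - n), by simp; omega, ?_⟩
      refine subset_of_append hsub' (l.take (l.length - n)) _ ?_
      rw [List.take_append_drop]
      exact hφ 0
  · ext φ
    obtain ⟨l, hl0, hl⟩ := Set.mem_iUnion₂.1 (Set.mem_iInter.1 φ.2 0)
    rw [List.length_eq_zero_iff.1 hl0] at hl
    simpa using hl
  · ext φ
    constructor
    · intro hφ
      obtain ⟨k, hk, hφk⟩ := Set.mem_iUnion₂.1 (Set.mem_iInter.1 φ.2 (l.length + 1))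
      rcases k with _ | ⟨b, k⟩
      · simp at hk
      · obtain rfl := hunique φ.1 k l (by simpa using hk) (hsub' _ _ hφk) hφ
        cases b
        exacts [Or.inr hφk, Or.inl hφk]
    · rintro (hφ | hφ)
      exacts [hsub' _ _ hφ, hsub' _ _ hφ]

/-- Iterates that are never empty would decrease strictly forever, injecting all ordinals into the
subsets of the dual of `E`. -/
theorem IsAsplund.index_ne_top {T : E →L[𝕜] F} (hT : IsAsplund T) : index T ≠ ⊤ := by
  refine SzlenkOp.index_ne_top fun ε hε => ?_
  by_contra! hne
  refine not_injective_of_ordinal (fun α : Ordinal.{u} => iterDeriv ε (dualBallImage T) α) ?_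
  have hanti : StrictAnti fun α : Ordinal.{u} => iterDeriv ε (dualBallImage T) α := by
    refine fun α β h => lt_of_le_of_lt (iterDeriv_antitone ε _ (add_one_le_of_lt h)) ?_
    rw [iterDeriv_add_one]
    refine (szDeriv_subset _ _).ssubset_of_not_subset
      (hT.not_subset_szDeriv (hne α) ?_ hε)
    simpa using iterDeriv_antitone ε (dualBallImage T) (zero_le (a := α))
  exact hanti.injective

end Asplund

end SzlenkOp

namespace SzlenkOp

open Order StrongDual WeakDual

/-- For `ζ ≠ 0`, `3 * ω ^ ζ = ω ^ ζ`, and powers of `ω` are closed under addition. -/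
theorem add_three_mul_lt {ζ α δ : Ordinal.{u}} (hζ : ζ ≠ 0) (hα : α < ω ^ ζ) (hδ : δ < ω ^ ζ) :
    δ + 3 * (α + 1) < ω ^ ζ := by
  have hl : IsSuccLimit (ω ^ ζ) := Ordinal.isSuccLimit_opow_left Ordinal.isSuccLimit_omega0 hζ
  refine Ordinal.isPrincipal_add_omega0_opow ζ hδ ?_
  have h3 : (3 : Ordinal.{u}) * ω ^ ζ = ω ^ ζ := by
    refine Ordinal.mul_omega0_dvd (by norm_num) (by exact_mod_cast Ordinal.natCast_lt_omega0 3) ?_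
    simpa using Ordinal.opow_dvd_opow ω (Order.one_le_iff_ne_zero.2 hζ)
  calc 3 * (α + 1) < 3 * ω ^ ζ := by
        gcongr
        exact hl.add_one_lt hα
    _ = ω ^ ζ := h3

/-! ### Assembling the two bounds -/

section Index

variable {𝕜 : Type*} [RCLike 𝕜]

theorem alphaOf_eq_add {E : Type u} [NormedAddCommGroup E] [NormedSpace 𝕜 E]
    {F : Type u} [NormedAddCommGroup F] [NormedSpace 𝕜 F] {T : E →L[𝕜] F} (h : alphaOf T ≠ 0) :
    alphaOf T = etaOf T + ω ^ zetaOf T :=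
  csInf_mem (s := {η | alphaOf T = η + ω ^ zetaOf T})
    (csInf_mem (s := {ζ | ∃ η : Ordinal.{u}, alphaOf T = η + ω ^ ζ}) (exists_eq_add_opow h))

namespace BanachOp

variable {C : ℝ≥0}

theorem derived_iter_nonempty_of_derived (T : BanachOp.{u} 𝕜 C) (r : SumExponent) {ε : ℝ}
    (hε : 0 ≤ ε) {β : Ordinal.{u}} (h : (T.derived ε β).Nonempty) (α : Ordinal.{u}) :
    ((T.iter r α).derived ε β).Nonempty := by
  induction α using Ordinal.limitRecOn with
  | zero => rwa [iter_zero]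
  | add_one α ih =>
    rw [iter_add_one]
    refine derived_sum_nonempty.{u, 0} r hε 0 ?_
    simpa using derived_copies_nonempty hε ih 1
  | limit α hα ih =>
    rw [iter_limit r T hα]
    refine derived_sum_nonempty.{u, u} r hε (Ordinal.ToType.mk ⟨0, hα.bot_lt⟩) ?_
    rw [show ((Ordinal.ToType.mk ⟨0, hα.bot_lt⟩).toOrd : Ordinal) = 0 from
      congrArg Subtype.val (Ordinal.ToType.mk.symm_apply_apply _)]
    exact ih 0 hα.bot_lt

theorem index_le_index_iter (T : BanachOp.{u} 𝕜 C) (r : SumExponent) (α : Ordinal.{u}) :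
    index T.op ≤ index (T.iter r α).op := by
  refine iSup₂_mono fun ε hε => le_iInf₂ fun β hβ => iInf₂_le β ?_
  by_contra hne
  exact (T.derived_iter_nonempty_of_derived r hε.le
    (Set.nonempty_iff_ne_empty.2 hne) α).ne_empty hβ

/-- For `ζ ≠ 0` the exponent `η + ω ^ ζ` is a limit, so by compactness the iterates are already
empty at some `ω ^ (η + δ)` with `δ < ω ^ ζ`. This `δ` depends on `ε` and leaves the room that the
construction uses up. -/
theorem exists_indexBound {T : BanachOp.{u} 𝕜 C} {η ζ : Ordinal.{u}} (hζ : ζ ≠ 0) {ε : ℝ}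
    (hε : 0 ≤ ε) (h : T.derived ε (ω ^ (η + ω ^ ζ)) = ∅) :
    ∃ δ < ω ^ ζ, T.IndexBound ε (η + δ) := by
  by_contra! hne
  have hl : IsSuccLimit (ω ^ ζ) := Ordinal.isSuccLimit_opow_left Ordinal.isSuccLimit_omega0 hζ
  have hl' : IsSuccLimit (η + ω ^ ζ) := Ordinal.isSuccLimit_add η hl
  refine (derived_limit_nonempty hε (Ordinal.isSuccLimit_opow Ordinal.one_lt_omega0 hl')
    fun β hβ => ?_).ne_empty h
  rw [Ordinal.lt_opow_of_isSuccLimit Ordinal.omega0_ne_zero hl'] at hβ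
  obtain ⟨δ, hδ, hβ⟩ := hβ
  obtain ⟨ξ, hξ, hδξ⟩ := (Ordinal.lt_add_iff hl.ne_bot).1 hδ
  refine derived_anti (hβ.le.trans (Ordinal.opow_le_opow_right Ordinal.omega0_pos hδξ)) ?_
  by_contra hemp
  refine hne ξ hξ fun δ hδ => ?_
  exact Set.subset_eq_empty (iterDeriv_anti_eps hε hδ.le _ _)
    (Set.not_nonempty_iff_eq_empty.1 hemp)

theorem index_iter_le {T : BanachOp.{u} 𝕜 C} {r : SumExponent} (hr : r.1 = 0 ∨ 1 < r.1)
    {η ζ α : Ordinal.{u}} (h : index T.op ≤ ((ω ^ (η + ω ^ ζ) : Ordinal.{u}) : WithTop Ordinal.{u}))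
    (hα : α < ω ^ ζ) :
    index (T.iter r α).op ≤ ((ω ^ (η + ω ^ ζ) : Ordinal.{u}) : WithTop Ordinal.{u}) := by
  by_cases hζ : ζ = 0
  -- Here there is no room, but `α < ω ^ 0 = 1` leaves only `T_0 = T`.
  · subst hζ
    rw [Ordinal.opow_zero, Order.lt_one_iff] at hα
    rwa [hα, iter_zero]
  refine index_le_iff.2 fun ε hε => ?_
  obtain ⟨δ, hδ, hb⟩ := exists_indexBound hζ (half_pos hε).le (index_le_iff.1 h _ (half_pos hε))
  refine ((hb.iter hr (half_pos hε).le α).mono ?_) ε (half_lt_self hε)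
  rw [add_assoc]
  gcongr
  exact (add_three_mul_lt hζ hα hδ).le

end BanachOp

end Index

end SzlenkOp

theorem proposition4p5 {𝕜 : Type} [RCLike 𝕜]
    {E : Type u} [NormedAddCommGroup E] [NormedSpace 𝕜 E] [CompleteSpace E]
    {F : Type u} [NormedAddCommGroup F] [NormedSpace 𝕜 F] [CompleteSpace F]
    (r : ℝ) (hr : r = 0 ∨ 1 < r)
    (T : E →L[𝕜] F) (hA : SzlenkOp.IsAsplund T) (hK : ¬ IsCompactOperator T) :
    -- the ordinals `α_T`, `ζ_T`, `η_T` are well defined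
    (SzlenkOp.index T = ((ω ^ SzlenkOp.alphaOf T : Ordinal.{u}) : WithTop Ordinal.{u}) ∧
      SzlenkOp.alphaOf T = SzlenkOp.etaOf T + ω ^ SzlenkOp.zetaOf T) ∧
    -- (i)
    (∀ ε : ℝ, 0 < ε →
      ((ω ^ SzlenkOp.etaOf T : Ordinal.{u}) : WithTop Ordinal.{u}) < SzlenkOp.epsIndex ε T →
      ∀ α : Ordinal.{u},
        ((ω ^ (SzlenkOp.etaOf T + α) : Ordinal.{u}) : WithTop Ordinal.{u}) <
          SzlenkOp.epsIndex ε
            ((SzlenkOp.bundle T).iter ⟨r, hr.imp_right le_of_lt⟩ α).op) ∧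
    -- (ii)
    (∀ α : Ordinal.{u}, α < ω ^ SzlenkOp.zetaOf T →
      SzlenkOp.index ((SzlenkOp.bundle T).iter ⟨r, hr.imp_right le_of_lt⟩ α).op =
        SzlenkOp.index T) := by
  have hidx := SzlenkOp.index_eq_opow_alphaOf hA.index_ne_top
  have h0 : SzlenkOp.alphaOf T ≠ 0 := fun h0 => hK <| by
    refine SzlenkOp.isCompactOperator_of_index_le_one T ?_
    rw [hidx, h0, Ordinal.opow_zero]
  have hadd := SzlenkOp.alphaOf_eq_add h0
  refine ⟨⟨hidx, hadd⟩, fun ε hε h α => ?_, fun α hα => ?_⟩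
  · exact SzlenkOp.lt_epsIndex_iff.2
      ((SzlenkOp.bundle T).derived_iter_nonempty _ hε.le (SzlenkOp.lt_epsIndex_iff.1 h) α)
  · refine le_antisymm ?_ ((SzlenkOp.bundle T).index_le_index_iter _ α)
    rw [hidx, hadd]
    refine SzlenkOp.BanachOp.index_iter_le hr ?_ hα
    rw [← hadd]
    exact hidx.le
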